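/- **Conventions.** $S^d$ is the unit sphere of $\mathbb{R}^{d+1}$. An $i$-dimensional subspace of $S^d$ is the intersection of $S^d$ with an $(i+1)$-dimensional linear subspace of $\mathbb{R}^{d+1}$; a hyperplane of $S^d$ is a $(d-1)$-dimensional subspace. A *2-arrangement* $\mathscr{A}$ in $S^d$ is a finite set of distinct $(d-2)$-dimensional subspaces of $S^d$ such that every nonempty intersection of its elements has even codimension (for $d<2$ only the empty arrangement is allowed). It is *essential* if the intersection of all its elements is empty, and *non-essential* otherwise. We also write $\mathscr{A}$ for the union of its elements. A *sign extension* of $\mathscr{A}=\{h_1,\dots,h_n\}$ is a choice of hyperplanes $H_i\supset h_i$, $1\le i\le n$; the subspaces $S^d$, $H_i$ and $h_i$ are said to *extend* $h_i$. A *hyperplane extension* $\mathscr{A}_e$ of $\mathscr{A}$ consists of all the subspaces $S^d, H_i, h_i$ together with a finite set of arbitrary further hyperplanes. For $S\subset\mathscr{A}_e$ and $x\in S^d$, the *stratum* of $x$ and $S$ is the set of points that can be joined to $x$ by a curve in $S^d$ that lies in all elements of $S$ and meets no element of $\mathscr{A}_e\setminus S$. The nonempty strata form the stratification $\mathbf{s}(\mathscr{A}_e)$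 of $S^d$; its faces are the closures of the strata. The extension is *fine* if the strata are the open cells of a regular CW complex structure on $S^d$; the stratification is then called *combinatorial*. For $M\subset S^d$, $\mathrm{R}(\mathbf{s},M)$ is the subcomplex of all faces of $\mathbf{s}$ contained in $M$. A closed hemisphere $F$ is in *general position* with respect to $\mathbf{s}$ if its boundary hyperplane $\partial F$ meets transversally the spherical span of every face of every polyhedron that is an intersection of one or more faces of $\mathbf{s}$. A *Morse matching* $\Phi$ on a regular CW complex $C$ is a set of pairs $(\sigma,\Sigma)$ of nonempty faces, $\sigma$ a codimension-one face of $\Sigma$, with no face in two pairs, and without closed gradient paths, i.e. without sequences $(\sigma_0,\Sigma_0),\dots,(\sigma_k,\Sigma_k)\in\Phi$, $k\ge1$, with $\sigma_{i+1}\ne\sigma_i$ a codimension-one face of $\Sigma_i$ for $0\le i<k$, and $\sigma_0=\sigma_k$. An elementary collapse deletes a nonempty face $\sigma$ that is strictly contained in exactly one other face, together with that face; $C$ collapses to $C'$ if a sequence of elementary collapses leads from $C$ to $C'$, and $C$ is collapsible if it collapses to a vertex. A *collapsing sequence* from $C$ to a subcomplex $C'$ is a Morse matching on $C$ whose unmatched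 faces are exactly the faces of $C'$. For a subcomplex $D\subset C$, a face of $D$ is *outwardly matched* if it is matched with a face not in $D$. The pair $(C,D)$ with $D\neq\emptyset$ is *out-$j$ collapsible* if $C$ collapses to some vertex $v$ of $D$ by a collapsing sequence all of whose outwardly matched faces have dimension $j$; it is a *collapsible pair* if the collapsing sequence to some vertex $v$ of $D$ can be chosen without outwardly matched faces. The pair $(C,\emptyset)$ is out-$j$ collapsible, and a collapsible pair, if $C$ is collapsible. **Theorem.** Let $\mathscr{A}$ be a nonempty 2-arrangement in $S^d$, let $\mathscr{A}_e$ be a fine hyperplane extension of $\mathscr{A}$, and let $\mathbf{s}=\mathbf{s}(\mathscr{A}_e)$. Let $F$ be a closed hemisphere in general position with respect to $\mathbf{s}$. Let $H\in\{S^d,H_i,h_i\}$ be any subspace extending an element $h_i$ of $\mathscr{A}$. Then: (A) the pair $\big(\mathrm{R}(\mathbf{s},F\cap H),\ \mathrm{R}(\mathbf{s},F\cap\mathscr{A}\cap H)\big)$ is out-$\big(\lfloor d/2\rfloor-1\big)$ collapsible; (B) if $\mathscr{A}$ is moreover non-essential, this pair is a collapsible pair. -/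

import Mathlib

noncomputable section

namespace HemisphereCollapse

/-! ### Spherical geometry -/

/-- The Euclidean space `ℝ^{d+1}` containing the sphere `S^d`. -/
abbrev Ambient (d : ℕ) : Type := EuclideanSpace ℝ (Fin (d + 1))

/-- The unit sphere `S^d ⊆ ℝ^{d+1}`. -/
def unitSphere (d : ℕ) : Set (Ambient d) := Metric.sphere 0 1

/-- A subspace of `S^d` is given by a linear subspace `V` of `ℝ^{d+1}`; this is its underlying
point set `V ∩ S^d`. -/
def subsphere {d : ℕ} (V : Submodule ℝ (Ambient d)) : Set (Ambient d) := unitSphere d ∩ V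

/-- The dimension of the subspace `V ∩ S^d` of `S^d`, that is `dim V - 1`. -/
def subsphereDim {d : ℕ} (V : Submodule ℝ (Ambient d)) : ℤ := (Module.finrank ℝ V : ℤ) - 1

/-- Hyperplanes of `S^d` are its `(d-1)`-dimensional subspaces. -/
def IsHyperplane {d : ℕ} (V : Submodule ℝ (Ambient d)) : Prop := subsphereDim V = (d : ℤ) - 1

/-- The closed hemisphere of `S^d` with inner normal vector `u` (used for `u ≠ 0`). -/
def closedHemisphere {d : ℕ} (u : Ambient d) : Set (Ambient d) :=
  {x | x ∈ unitSphere d ∧ 0 ≤ inner ℝ u x}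

/-- The hyperplane `u^⊥`; for `u ≠ 0` it cuts out the boundary of `closedHemisphere u`. -/
def normalHyperplane {d : ℕ} (u : Ambient d) : Submodule ℝ (Ambient d) :=
  (Submodule.span ℝ {u})ᗮ

/-- The great subspheres `V ∩ S^d` and `W ∩ S^d` meet transversally: they are disjoint, or
(equivalently at one or at every common point) their tangent spaces span that of `S^d`. -/
def Transversal {d : ℕ} (V W : Submodule ℝ (Ambient d)) : Prop := V ⊓ W = ⊥ ∨ V ⊔ W = ⊤

/-- `G` is a face of the spherical polyhedron `P`: the intersection of `P` with the hyperplane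
`w^⊥` of a closed hemisphere (or, for `w = 0`, with everything) containing `P`. -/
def IsFaceOfPolyhedron {d : ℕ} (G P : Set (Ambient d)) : Prop :=
  ∃ w : Ambient d, (∀ x ∈ P, 0 ≤ inner ℝ w x) ∧ G = {x | x ∈ P ∧ inner ℝ w x = 0}

/-- The hyperplane `W` is in general position to the collection `P` of polyhedra: it meets
transversally the spherical span of every face of every element of `P`, and of every face of
every intersection of elements of `P`. -/
def InGeneralPosition {d : ℕ} (W : Submodule ℝ (Ambient d)) (P : Set (Set (Ambient d))) : Prop :=
  ∀ T : Set (Set (Ambient d)), T ⊆ P → T.Nonempty →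
    ∀ G : Set (Ambient d), IsFaceOfPolyhedron G (⋂₀ T) → Transversal W (Submodule.span ℝ G)

/-! ### Arrangements, extensions, stratifications -/

/-- `A` is a 2-arrangement in `S^d`: a finite set of `(d-2)`-dimensional subspaces of `S^d`, with
all nonempty intersections of even codimension; for `d < 2` only the empty one. -/
structure IsTwoArrangement {d : ℕ} (A : Set (Submodule ℝ (Ambient d))) : Prop where
  finite : A.Finite
  two_le : A.Nonempty → 2 ≤ d
  dim_eq : ∀ h ∈ A, subsphereDim h = (d : ℤ) - 2
  codim_even : ∀ B ⊆ A, (subsphere (sInf B)).Nonempty → 2 ∣ (d : ℤ) - subsphereDim (sInf B)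

/-- The union of the elements of an arrangement, as a subset of `S^d`. -/
def arrangementUnion {d : ℕ} (A : Set (Submodule ℝ (Ambient d))) : Set (Ambient d) :=
  ⋃ h ∈ A, subsphere h

/-- `A` is essential if the intersection of all its elements (in `S^d`) is empty. The empty
arrangement is non-essential, since `sInf ∅ = ⊤`. -/
def IsEssential {d : ℕ} (A : Set (Submodule ℝ (Ambient d))) : Prop := subsphere (sInf A) = ∅

/-- A hyperplane extension of `A`: a hyperplane `sign h ⊇ h` for every `h ∈ A` (the sign
extension), and finitely many arbitrary further hyperplanes. -/
structure HyperplaneExtension {d : ℕ} (A : Set (Submodule ℝ (Ambient d))) where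
  sign : A → Submodule ℝ (Ambient d)
  sign_isHyperplane : ∀ h, IsHyperplane (sign h)
  le_sign : ∀ h : A, (h : Submodule ℝ (Ambient d)) ≤ sign h
  extra : Set (Submodule ℝ (Ambient d))
  extra_finite : extra.Finite
  extra_isHyperplane : ∀ K ∈ extra, IsHyperplane K

namespace HyperplaneExtension

variable {d : ℕ} {A : Set (Submodule ℝ (Ambient d))}

/-- The subspaces of the extension which extend `h`: `S^d`, the chosen hyperplane, `h` itself. -/
def Extends (E : HyperplaneExtension A) (H : Submodule ℝ (Ambient d)) (h : A) : Prop :=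
  H = ⊤ ∨ H = E.sign h ∨ H = h

/-- All subspaces by which the extension subdivides `S^d`: those extending an element of `A`
(hence also the elements of `A` themselves) and the additional hyperplanes. -/
def elements (E : HyperplaneExtension A) : Set (Submodule ℝ (Ambient d)) :=
  {H | ∃ h, E.Extends H h} ∪ E.extra

/-- The stratum of `x` and `S`: the points that can be joined to `x` by a curve in `S^d` lying in
all elements of `S` and meeting no other element of the extension. -/
def stratum (E : HyperplaneExtension A) (S : Set (Submodule ℝ (Ambient d))) (x : Ambient d) :
    Set (Ambient d) :=
  {y | JoinedIn {z | z ∈ unitSphere d ∧ (∀ K ∈ S, z ∈ K) ∧ ∀ K ∈ E.elements \ S, z ∉ K} x y}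

/-- The stratification of `S^d` given by the extension: the set of nonempty strata. -/
def strata (E : HyperplaneExtension A) : Set (Set (Ambient d)) :=
  {c | c.Nonempty ∧ ∃ S ⊆ E.elements, ∃ x, c = E.stratum S x}

/-- The extension is fine: the strata are the open cells of a regular CW complex structure on
`S^d`, regular meaning that the characteristic maps are injective on closed balls. -/
def IsFine (E : HyperplaneExtension A) : Prop :=
  ∃ K : Topology.CWComplex (unitSphere d),
    {c | ∃ (n : ℕ) (i : K.cell n), c = K.map n i '' Metric.ball 0 1} = E.strata ∧
    ∀ (n : ℕ) (i : K.cell n), Set.InjOn (K.map n i) (Metric.closedBall 0 1)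

/-- The (nonempty, closed) faces of the stratification: the closures of the strata. -/
def faces (E : HyperplaneExtension A) : Set (Set (Ambient d)) := closure '' E.strata

end HyperplaneExtension

/-! ### Collapses and Morse matchings

A complex is given by the set of its nonempty closed faces. Every face considered is the closure
of a convex stratum of a sphere, so its dimension is that of its linear span minus one. -/

section Collapse

variable {V : Type*} [AddCommGroup V] [Module ℝ V]

/-- The dimension of a face. -/
def faceDim (s : Set V) : ℤ := (Module.finrank ℝ (Submodule.span ℝ s) : ℤ) - 1

/-- `s` is a codimension-one face of `t`. -/
def IsCodimOneFace (s t : Set V) : Prop := s ⊂ t ∧ faceDim t = faceDim s + 1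

/-- `D` is a subcomplex of `C`. -/
def IsSubcomplex (D C : Set (Set V)) : Prop :=
  D ⊆ C ∧ ∀ t ∈ D, ∀ s ∈ C, s ⊆ t → s ∈ D

/-- The restriction `R(C, M)`: the faces of `C` contained in `M`. -/
def restriction (C : Set (Set V)) (M : Set V) : Set (Set V) := {s | s ∈ C ∧ s ⊆ M}

/-- Deleting a face `s` (and what contains it) that is strictly contained in exactly one face. -/
def ElementaryCollapse (C C' : Set (Set V)) : Prop :=
  ∃ s ∈ C, (∃! t, t ∈ C ∧ s ⊂ t) ∧ C' = {r | r ∈ C ∧ ¬ s ⊆ r}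

/-- `C ↘ C'`. -/
def Collapses (C C' : Set (Set V)) : Prop := Relation.ReflTransGen ElementaryCollapse C C'

/-- `C` collapses to some vertex. -/
def IsCollapsible (C : Set (Set V)) : Prop := ∃ v ∈ C, faceDim v = 0 ∧ Collapses C {v}

/-- A discrete vector field on `C`. -/
structure IsDiscreteVectorField (C : Set (Set V)) (Φ : Set (Set V × Set V)) : Prop where
  mem : ∀ p ∈ Φ, p.1 ∈ C ∧ p.2 ∈ C
  codim_one : ∀ p ∈ Φ, IsCodimOneFace p.1 p.2
  disjoint : ∀ p ∈ Φ, ∀ q ∈ Φ, p ≠ q → p.1 ≠ q.1 ∧ p.1 ≠ q.2 ∧ p.2 ≠ q.1 ∧ p.2 ≠ q.2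

/-- The pairs `(s 0, t 0), …, (s k, t k)` form a closed gradient path. -/
def IsClosedGradientPath (Φ : Set (Set V × Set V)) (k : ℕ) (s t : ℕ → Set V) : Prop :=
  1 ≤ k ∧ (∀ i ≤ k, (s i, t i) ∈ Φ) ∧
    (∀ i < k, s (i + 1) ≠ s i ∧ IsCodimOneFace (s (i + 1)) (t i)) ∧ s 0 = s k

/-- A Morse matching: a discrete vector field without closed gradient paths. -/
def IsMorseMatching (C : Set (Set V)) (Φ : Set (Set V × Set V)) : Prop :=
  IsDiscreteVectorField C Φ ∧ ∀ k s t, ¬ IsClosedGradientPath Φ k s t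

/-- The faces of `C` that are in no matching pair. -/
def criticalFaces (C : Set (Set V)) (Φ : Set (Set V × Set V)) : Set (Set V) :=
  {s | s ∈ C ∧ ∀ p ∈ Φ, p.1 ≠ s ∧ p.2 ≠ s}

/-- A collapsing sequence from `C` to the subcomplex `C'`: a Morse matching on `C` whose critical
faces are exactly the faces of `C'`. -/
def IsCollapsingSequence (C C' : Set (Set V)) (Φ : Set (Set V × Set V)) : Prop :=
  IsSubcomplex C' C ∧ IsMorseMatching C Φ ∧ criticalFaces C Φ = C'

/-- The face `s` of `D` is matched with a face that does not belong to `D`. -/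
def IsOutwardlyMatched (D : Set (Set V)) (Φ : Set (Set V × Set V)) (s : Set V) : Prop :=
  s ∈ D ∧ ∃ t, t ∉ D ∧ ((s, t) ∈ Φ ∨ (t, s) ∈ Φ)

/-- The pair `(C, D)` out-`j` collapses to `(C', D ∩ C')`. -/
def OutCollapses (j : ℤ) (C D C' : Set (Set V)) : Prop :=
  Collapses C C' ∧ ∃ Φ, IsCollapsingSequence C C' Φ ∧
    ∀ s, IsOutwardlyMatched D Φ s → faceDim s = j

/-- The pair `(C, D)`, with `D` a subcomplex of `C`, is out-`j` collapsible. -/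
def IsOutCollapsible (j : ℤ) (C D : Set (Set V)) : Prop :=
  IsSubcomplex D C ∧
    ((D = ∅ ∧ IsCollapsible C) ∨ ∃ v ∈ D, faceDim v = 0 ∧ OutCollapses j C D {v})

/-- The pair `(C, D)` is a collapsible pair: `D = ∅` and `C` is collapsible, or `C` collapses to
a vertex of `D` by a collapsing sequence without outwardly matched faces (such a pair is
out-`j` collapsible for every `j`). -/
def IsCollapsiblePair (C D : Set (Set V)) : Prop :=
  IsSubcomplex D C ∧
    ((D = ∅ ∧ IsCollapsible C) ∨ ∃ v ∈ D, faceDim v = 0 ∧ Collapses C {v} ∧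
      ∃ Φ, IsCollapsingSequence C {v} Φ ∧ ∀ s, ¬ IsOutwardlyMatched D Φ s)

end Collapse

end HemisphereCollapse

end

/-! Choose functionals (f_i, g_i) with ker f_i = H_i and ker f_i ∩ ker g_i = h_i, taking g = 0 for
the extra hyperplanes. If only the origin is common to all subspaces, the strata are the traces on
the sphere of the nonzero fibres of a "complex" sign vector. By general position, the faces in the
hemisphere are the sign vectors of nonzero cones on whose closure u is positive off the origin.
Adding the zero cone as empty face, the task is to remove all these sign vectors by free pairs. The
zero cone must go last, together with a vertex, so a complete removal is a collapse to a vertex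
(`Coll.remove_bot`, `Represents.exists_collapsingSequence`).

The engine is a sweep. Let l be a functional whose kernel no cone crosses, and perturb u so that u
and l become independent on the relevant spans. Process the vertices v with l v ≠ 0 in order of
decreasing |l|/u. The faces still present that contain v correspond to the link of v in an open
half-space, again in general position and one dimension lower (`star_eq_image`, `link_genPos`).
Induction removes them, and what is left lies in ker l (`sweep`, `coll_of_link_of_ker`). Without an
arrangement this already gives collapsibility (`coll_cells`).

To respect the arrangement, sweep first with f_i to reach H_i, then inside H_i with g_i to reach
h_i, where every face lies in the arrangement and nothing is matched outwardly. In both sweeps the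
relevant arrangement in the link consists of the elements through v. Its intersections are trivial
or of even codimension. On H_i this holds because an intersection L not contained in h_i meets h_i
in codimension one, and L ∩ h_i has even codimension in the whole space.

Outward matches come only from essential link arrangements. As the intersection of 𝒜 lies in ker l
and v does not, an essential link forces 𝒜 to be essential; this gives (B). For (A), ranks in a link
are shifted by one, and parity makes the rank of an outwardly matched cone always ⌊(n-1)/2⌋ with n
the dimension of the linear space. For n = d+1 this is face dimension ⌊d/2⌋-1
(`coll_cells_of_evenCodim`).

Fineness still allows a pair of antipodal points common to all subspaces. Then every other face
contains both points, so both complexes are one vertex. -/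

namespace HemisphereCollapse

/-! ### Collapses with restricted matching pairs -/

section Coll

variable {α β : Type*} [PartialOrder α] [PartialOrder β]

/-- Removal of a free element `s` together with the only element `t` above it, where `Q s t`. -/
def PairRemoval (Q : α → α → Prop) (C C' : Set α) : Prop :=
  ∃ s ∈ C, ∃ t ∈ C, s < t ∧ Q s t ∧ (∀ r ∈ C, s < r → r = t) ∧ C' = C \ {s, t}

/-- Sequences of removals of free pairs satisfying `Q`. -/
def Coll (Q : α → α → Prop) : Set α → Set α → Prop := Relation.ReflTransGen (PairRemoval Q)

theorem PairRemoval.subset {Q : α → α → Prop} {C C' : Set α} (h : PairRemoval Q C C') :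
    C' ⊆ C := by
  obtain ⟨s, -, t, -, -, -, -, rfl⟩ := h
  exact Set.sdiff_subset

theorem Coll.mono {Q Q' : α → α → Prop} {C C' : Set α} (h : Coll Q C C')
    (hQ : ∀ s ∈ C, ∀ t ∈ C, Q s t → Q' s t) : Coll Q' C C' := by
  induction h using Relation.ReflTransGen.head_induction_on with
  | refl => exact Relation.ReflTransGen.refl
  | head h1 _ ih =>
    refine Relation.ReflTransGen.head ?_ (ih fun s hs t ht => hQ s (h1.subset hs) t (h1.subset ht))
    obtain ⟨s, hs, t, ht, hst, hq, hf, rfl⟩ := h1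
    exact ⟨s, hs, t, ht, hst, hQ s hs t ht hq, hf, rfl⟩

/-- The elements of `B` are bystanders: none lies above an element of the image, so free pairs stay
free. It transplants a removal of the link into the complex containing the star. -/
theorem Coll.image {Q : β → β → Prop} {f : α → β} {C C' : Set α} {B : Set β}
    (h : Coll (fun s t => Q (f s) (f t)) C C')
    (hf : ∀ s ∈ C, ∀ t ∈ C, f s ≤ f t ↔ s ≤ t)
    (hB : ∀ s ∈ C, ∀ b ∈ B, ¬ f s ≤ b) :
    Coll Q (B ∪ f '' C) (B ∪ f '' C') := by
  induction h using Relation.ReflTransGen.head_induction_on with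
  | refl => exact Relation.ReflTransGen.refl
  | head h1 _ ih =>
    refine Relation.ReflTransGen.head ?_ (ih
      (fun s hs t ht => hf s (h1.subset hs) t (h1.subset ht)) (fun s hs => hB s (h1.subset hs)))
    obtain ⟨s, hs, t, ht, hst, hq, hfree, rfl⟩ := h1
    have hinj : ∀ a ∈ _, ∀ b ∈ _, f a = f b → a = b := fun a ha b hb hab =>
      le_antisymm ((hf a ha b hb).1 hab.le) ((hf b hb a ha).1 hab.ge)
    have hlt : ∀ a ∈ _, ∀ b ∈ _, f a < f b ↔ a < b := fun a ha b hb => by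
      rw [lt_iff_le_not_ge, lt_iff_le_not_ge, hf a ha b hb, hf b hb a ha]
    refine ⟨f s, Or.inr ⟨s, hs, rfl⟩, f t, Or.inr ⟨t, ht, rfl⟩, (hlt s hs t ht).2 hst, hq, ?_, ?_⟩
    · rintro r (hr | ⟨r, hr, rfl⟩) hsr
      · exact absurd hsr.le (hB s hs r hr)
      · rw [hfree r hr ((hlt s hs r hr).1 hsr)]
    · ext r
      constructor
      · rintro (hr | ⟨r, ⟨hr, hr'⟩, rfl⟩)
        · refine ⟨Or.inl hr, ?_⟩
          rintro (rfl | rfl)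
          · exact hB s hs _ hr le_rfl
          · exact hB t ht _ hr le_rfl
        · refine ⟨Or.inr ⟨r, hr, rfl⟩, ?_⟩
          rintro (h | h)
          · exact hr' (Or.inl (hinj r hr s hs h))
          · exact hr' (Or.inr (hinj r hr t ht h))
      · rintro ⟨hr | ⟨r, hr, rfl⟩, hr'⟩
        · exact Or.inl hr
        · refine Or.inr ⟨r, ⟨hr, ?_⟩, rfl⟩
          rintro (rfl | rfl)
          · exact hr' (Or.inl rfl)
          · exact hr' (Or.inr rfl)

/-- A complete removal ends with a pair consisting of the bottom element and an atom. -/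
theorem Coll.remove_bot {Q : α → α → Prop} {C : Set α} {b : α} (h : Coll Q C ∅) (hb : b ∈ C)
    (hbot : ∀ s ∈ C, b ≤ s) :
    ∃ v ∈ C, b < v ∧ Q b v ∧ Coll Q (C \ {b}) {v} := by
  induction h using Relation.ReflTransGen.head_induction_on with
  | refl => exact absurd hb (Set.notMem_empty b)
  | @head C₁ C₂ h1 _ ih =>
    have hsub := h1.subset
    obtain ⟨s, hs, t, ht, hst, hq, hf, rfl⟩ := h1
    by_cases hsb : s = b
    · subst hsb
      refine ⟨t, ht, hst, hq, ?_⟩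
      have : C₁ \ {s} = {t} := by
        ext r
        constructor
        · rintro ⟨hr, hrs⟩
          exact hf r hr (lt_of_le_of_ne (hbot r hr) fun h => hrs h.symm)
        · rintro rfl
          exact ⟨ht, fun h => hst.ne' h⟩
      rw [this]
      exact Relation.ReflTransGen.refl
    · have htb : t ≠ b := by
        rintro rfl
        exact absurd (hbot s hs) hst.not_ge
      obtain ⟨v, hv, hbv, hqv, hcoll⟩ := ih ⟨hb, by
        rintro (h | h)
        · exact hsb h.symm
        · exact htb h.symm⟩ (fun r hr => hbot r hr.1)
      refine ⟨v, hv.1, hbv, hqv, Relation.ReflTransGen.head ?_ hcoll⟩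
      refine ⟨s, ⟨hs, hsb⟩, t, ⟨ht, htb⟩, hst, hq, fun r hr => hf r hr.1, ?_⟩
      ext r
      simp only [Set.mem_sdiff]
      tauto

end Coll

/-! ### From restricted collapses to collapsing sequences -/

section Faces

variable {V : Type*}

theorem Coll.collapses {Q : Set V → Set V → Prop} {C C' : Set (Set V)} (h : Coll Q C C') :
    Collapses C C' := by
  refine Relation.ReflTransGen.mono (fun C C' => ?_) C C' h
  rintro ⟨s, hs, t, ht, hst, -, hf, rfl⟩
  refine ⟨s, hs, ⟨t, ⟨ht, hst⟩, fun r hr => hf r hr.1 hr.2⟩, ?_⟩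
  ext r
  constructor
  · rintro ⟨hr, hr'⟩
    refine ⟨hr, fun hsr => hr' ?_⟩
    rcases eq_or_lt_of_le (show s ≤ r from hsr) with h | h
    · exact Or.inl h.symm
    · exact Or.inr (hf r hr h)
  · rintro ⟨hr, hr'⟩
    refine ⟨hr, ?_⟩
    rintro (rfl | rfl)
    · exact hr' subset_rfl
    · exact hr' hst.le

/-- Prepending a free pair (s, t) creates no closed gradient path: a path can enter s only from a
face above s, that is from t, whose partner is s itself, and consecutive lower faces differ. -/
theorem Coll.exists_matching [AddCommGroup V] [Module ℝ V] {Q : Set V → Set V → Prop}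
    {C C' : Set (Set V)} (h : Coll Q C C')
    (hQ : ∀ s t, Q s t → faceDim t = faceDim s + 1) :
    C' ⊆ C ∧ ∃ Φ, IsMorseMatching C Φ ∧ criticalFaces C Φ = C' ∧ ∀ p ∈ Φ, Q p.1 p.2 := by
  induction h using Relation.ReflTransGen.head_induction_on with
  | refl =>
    refine ⟨subset_rfl, ∅, ⟨⟨by simp, by simp, by simp⟩, ?_⟩, by simp [criticalFaces], by simp⟩
    rintro k s t ⟨-, h, -⟩
    exact h 0 (Nat.zero_le k)
  | @head C₁ C₂ h1 _ ih =>
    have hsub := h1.subset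
    obtain ⟨hC', Φ, ⟨hΦ, hacyc⟩, hcrit, hΦQ⟩ := ih
    obtain ⟨s, hs, t, ht, hst, hq, hf, rfl⟩ := h1
    have hnot : ∀ p ∈ Φ, (p.1 ≠ s ∧ p.1 ≠ t) ∧ p.2 ≠ s ∧ p.2 ≠ t := fun p hp => by
      have h := hΦ.mem p hp
      exact ⟨⟨fun h' => h.1.2 (Or.inl h'), fun h' => h.1.2 (Or.inr h')⟩,
        fun h' => h.2.2 (Or.inl h'), fun h' => h.2.2 (Or.inr h')⟩
    refine ⟨hC'.trans hsub, insert (s, t) Φ, ⟨⟨?_, ?_, ?_⟩, ?_⟩, ?_, ?_⟩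
    · rintro p (rfl | hp)
      · exact ⟨hs, ht⟩
      · exact ⟨(hΦ.mem p hp).1.1, (hΦ.mem p hp).2.1⟩
    · rintro p (rfl | hp)
      · exact ⟨hst, hQ _ _ hq⟩
      · exact hΦ.codim_one p hp
    · rintro p (rfl | hp) q (rfl | hq') hpq
      · exact absurd rfl hpq
      · have := hnot q hq'
        exact ⟨this.1.1.symm, this.2.1.symm, this.1.2.symm, this.2.2.symm⟩
      · have := hnot p hp
        exact ⟨this.1.1, this.1.2, this.2.1, this.2.2⟩
      · exact hΦ.disjoint p hp q hq' hpq
    · rintro k S T ⟨hk, hmem, hface, hclosed⟩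
      have hmemC : ∀ i ≤ k, S i ∈ C₁ ∧ T i ∈ C₁ := fun i hi => by
        rcases hmem i hi with h | h
        · rw [Prod.mk.injEq] at h
          rw [h.1, h.2]
          exact ⟨hs, ht⟩
        · exact ⟨(hΦ.mem _ h).1.1, (hΦ.mem _ h).2.1⟩
      have hsucc : ∀ i < k, S (i + 1) ≠ s := fun i hi h => by
        have h1 : T i = t := hf _ (hmemC i hi.le).2 (by rw [← h]; exact (hface i hi).2.1)
        have h2 : S i = s := by
          rcases hmem i hi.le with h' | h'
          · exact (Prod.mk.injEq .. ▸ h').1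
          · exact absurd h1 (hnot _ h').2.2
        exact (hface i hi).1 (h.trans h2.symm)
      -- The initial index has no predecessor; closedness replaces it by the index k ≥ 1.
      have hne : ∀ i ≤ k, S i ≠ s := fun i hi => by
        rcases i with _ | i
        · rw [hclosed]
          obtain ⟨k, rfl⟩ := Nat.exists_eq_add_of_le' hk
          exact hsucc k (Nat.lt_succ_self k)
        · exact hsucc i hi
      refine hacyc k S T ⟨hk, fun i hi => ?_, hface, hclosed⟩
      rcases hmem i hi with h | h
      · rw [Prod.mk.injEq] at h
        exact absurd h.1 (hne i hi)
      · exact h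
    · rw [← hcrit]
      ext r
      simp only [criticalFaces, Set.mem_ofPred_eq, Set.mem_insert_iff, forall_eq_or_imp,
        Set.mem_sdiff, Set.mem_singleton_iff, not_or]
      constructor
      · rintro ⟨hr, ⟨h1, h2⟩, h3⟩
        exact ⟨⟨hr, Ne.symm h1, Ne.symm h2⟩, h3⟩
      · rintro ⟨⟨hr, h1, h2⟩, h3⟩
        exact ⟨hr, ⟨Ne.symm h1, Ne.symm h2⟩, h3⟩
    · rintro p (rfl | hp)
      · exact hq
      · exact hΦQ p hp

end Faces

/-! ### Complex signs -/

/-- The sign of `(a, b)`: that of `a` if `a ≠ 0` (`pos`, `neg`), else that of `b`. -/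
inductive CSign
  | zero | ipos | ineg | pos | neg
  deriving DecidableEq

namespace CSign

/-- The face order on complex signs. -/
def leB : CSign → CSign → Bool
  | zero, _ => true
  | ipos, ipos => true
  | ipos, pos => true
  | ipos, neg => true
  | ineg, ineg => true
  | ineg, pos => true
  | ineg, neg => true
  | pos, pos => true
  | neg, neg => true
  | _, _ => false

instance : Fintype CSign where
  elems := {zero, ipos, ineg, pos, neg}
  complete a := by cases a <;> decide

instance : PartialOrder CSign where
  le a b := leB a b = true
  le_refl := by decide
  le_trans := by decide
  le_antisymm := by decide

instance : DecidableLE CSign := fun a b => inferInstanceAs (Decidable (leB a b = true))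

/-- The complex sign of a pair of real numbers. -/
noncomputable def ofReal (a b : ℝ) : CSign :=
  if 0 < a then pos else if a < 0 then neg else if 0 < b then ipos else if b < 0 then ineg else zero

/-- The composition of signs: the sign of `a` perturbed in the direction of `b`. -/
def comp : CSign → CSign → CSign
  | zero, b => b
  | ipos, pos => pos
  | ipos, neg => neg
  | ipos, _ => ipos
  | ineg, pos => pos
  | ineg, neg => neg
  | ineg, _ => ineg
  | a, _ => a

/-- For fixed (a', b') the right side consists of weak linear conditions on (a, b), so that closed
cones are visibly closed and convex. -/
theorem ofReal_le_iff {a b a' b' : ℝ} : ofReal a b ≤ ofReal a' b' ↔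
    (0 < a' → 0 ≤ a) ∧ (a' < 0 → a ≤ 0) ∧ (a' = 0 → a = 0) ∧
      (a' = 0 → 0 < b' → 0 ≤ b) ∧ (a' = 0 → b' < 0 → b ≤ 0) ∧ (a' = 0 → b' = 0 → b = 0) := by
  have key : ∀ x : ℝ, (0 < x ∧ ¬ x < 0 ∧ x ≠ 0) ∨ (¬ 0 < x ∧ x < 0 ∧ x ≠ 0) ∨ x = 0 := fun x => by
    rcases lt_trichotomy x 0 with h | h | h
    · exact Or.inr (Or.inl ⟨h.not_gt, h, h.ne⟩)
    · exact Or.inr (Or.inr h)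
    · exact Or.inl ⟨h, h.not_gt, h.ne'⟩
  rcases key a' with h1 | h1 | rfl <;> rcases key b' with h2 | h2 | rfl <;>
    rcases key a with h3 | h3 | rfl <;> rcases key b with h4 | h4 | rfl <;>
    simp [ofReal, *, ← not_lt] <;> decide

theorem ofReal_eq_iff {a b a' b' : ℝ} : ofReal a b = ofReal a' b' ↔
    (0 < a' ↔ 0 < a) ∧ (a' < 0 ↔ a < 0) ∧
      (a' = 0 → (0 < b' ↔ 0 < b) ∧ (b' < 0 ↔ b < 0)) := by
  have key : ∀ x : ℝ, (0 < x ∧ ¬ x < 0 ∧ x ≠ 0) ∨ (¬ 0 < x ∧ x < 0 ∧ x ≠ 0) ∨ x = 0 := fun x => by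
    rcases lt_trichotomy x 0 with h | h | h
    · exact Or.inr (Or.inl ⟨h.not_gt, h, h.ne⟩)
    · exact Or.inr (Or.inr h)
    · exact Or.inl ⟨h, h.not_gt, h.ne'⟩
  rcases key a' with h1 | h1 | rfl <;> rcases key b' with h2 | h2 | rfl <;>
    rcases key a with h3 | h3 | rfl <;> rcases key b with h4 | h4 | rfl <;>
    simp [ofReal, *]

theorem ofReal_eq_zero_iff {a b : ℝ} : ofReal a b = zero ↔ a = 0 ∧ b = 0 := by
  have h : zero = ofReal 0 0 := by simp [ofReal]
  rw [h, le_antisymm_iff, ofReal_le_iff, ofReal_le_iff]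
  simp only [lt_self_iff_false, le_refl, implies_true, true_and, false_implies, forall_const]
  tauto

/-- The signs occurring in direction of a stratification localized at a point with sign `a`. -/
def Allowed : CSign → CSign → Bool
  | zero, _ => true
  | ipos, zero => true
  | ipos, pos => true
  | ipos, neg => true
  | ineg, zero => true
  | ineg, pos => true
  | ineg, neg => true
  | pos, zero => true
  | neg, zero => true
  | _, _ => false

/-- Composition forgets whatever `a` already decides; allowed signs carry no such information, so
nothing is lost. -/
theorem comp_le_comp_iff : ∀ {a p q : CSign}, a.Allowed p = true → a.Allowed q = true →
    (a.comp p ≤ a.comp q ↔ p ≤ q) := by decide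

theorem le_comp : ∀ a p : CSign, a ≤ a.comp p := by decide

/-- The signs of the pairs whose first entry vanishes. -/
def Low (a : CSign) : Prop := a ≠ pos ∧ a ≠ neg

instance : DecidablePred Low := fun a => inferInstanceAs (Decidable (a ≠ pos ∧ a ≠ neg))

theorem comp_eq_zero_iff : ∀ {a p : CSign}, a.comp p = zero ↔ a = zero ∧ p = zero := by decide

theorem low_comp_iff : ∀ {a p : CSign}, a.Allowed p = true →
    ((a.comp p).Low ↔ a.Low ∧ p.Low) := by decide

theorem low_ofReal_iff {a b : ℝ} : (ofReal a b).Low ↔ a = 0 := by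
  rcases lt_trichotomy a 0 with h | rfl | h
  · simp [ofReal, Low, h, h.not_gt, h.ne]
  · simp only [ofReal, lt_self_iff_false, if_false, iff_true]
    split_ifs <;> decide
  · simp [ofReal, Low, h, h.ne']

end CSign

/-! ### Stratifications by pairs of linear functionals -/

section Data

variable {ι : Type*} {V : Type*} [AddCommGroup V] [Module ℝ V]

/-- The complex sign vector of a point. Its fibres are the strata. -/
noncomputable def signVec (E : ι → (V →ₗ[ℝ] ℝ) × (V →ₗ[ℝ] ℝ)) (x : V) : ι → CSign :=
  fun i => CSign.ofReal ((E i).1 x) ((E i).2 x)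

/-- The linear span of the stratum with a given sign vector. -/
def flat (E : ι → (V →ₗ[ℝ] ℝ) × (V →ₗ[ℝ] ℝ)) (σ : ι → CSign) : Submodule ℝ V where
  carrier := {y | ∀ i, ((σ i).Low → (E i).1 y = 0) ∧ (σ i = CSign.zero → (E i).2 y = 0)}
  add_mem' := fun {x y} hx hy i => by
    refine ⟨fun h => ?_, fun h => ?_⟩
    · rw [map_add, (hx i).1 h, (hy i).1 h, add_zero]
    · rw [map_add, (hx i).2 h, (hy i).2 h, add_zero]
  zero_mem' := fun i => by simp
  smul_mem' := fun c x hx i => by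
    refine ⟨fun h => ?_, fun h => ?_⟩
    · rw [map_smul, (hx i).1 h, smul_zero]
    · rw [map_smul, (hx i).2 h, smul_zero]

/-- The dimension of the cone with a given sign vector. -/
noncomputable def rank (E : ι → (V →ₗ[ℝ] ℝ) × (V →ₗ[ℝ] ℝ)) (σ : ι → CSign) : ℕ := Module.finrank ℝ (flat E σ)

variable {E : ι → (V →ₗ[ℝ] ℝ) × (V →ₗ[ℝ] ℝ)}

theorem mem_flat_iff {σ : ι → CSign} {y : V} :
    y ∈ flat E σ ↔ ∀ i, ((σ i).Low → (E i).1 y = 0) ∧ (σ i = CSign.zero → (E i).2 y = 0) := Iff.rfl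

theorem mem_flat_signVec {x y : V} : y ∈ flat E (signVec E x) ↔
    ∀ i, ((E i).1 x = 0 → (E i).1 y = 0) ∧ ((E i).1 x = 0 → (E i).2 x = 0 → (E i).2 y = 0) := by
  simp only [mem_flat_iff, signVec, CSign.low_ofReal_iff, CSign.ofReal_eq_zero_iff, and_imp]

theorem self_mem_flat (x : V) : x ∈ flat E (signVec E x) :=
  mem_flat_signVec.2 fun _ => ⟨id, fun _ => id⟩

theorem mem_flat_of_le {x y : V} (h : signVec E y ≤ signVec E x) : y ∈ flat E (signVec E x) :=
  mem_flat_signVec.2 fun i => by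
    have := CSign.ofReal_le_iff.1 (h i)
    exact ⟨this.2.2.1, this.2.2.2.2.2⟩

theorem signVec_zero : signVec E 0 = fun _ => CSign.zero := by
  funext i
  simp [signVec, CSign.ofReal_eq_zero_iff]

theorem signVec_zero_le (σ : ι → CSign) : signVec E 0 ≤ σ := by
  rw [signVec_zero]
  intro i
  show CSign.leB _ _ = true
  cases σ i <;> rfl

/-- A point of the open cone plus a point of its closure stays in the open cone: the closed
conditions on y cannot spoil the strict ones on x. -/
theorem signVec_smul_add {x y : V} (h : signVec E y ≤ signVec E x) {a b : ℝ} (ha : 0 < a)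
    (hb : 0 ≤ b) : signVec E (a • x + b • y) = signVec E x := by
  funext i
  obtain ⟨h1, h2, h3, h4, h5, h6⟩ := CSign.ofReal_le_iff.1 (h i)
  simp only [signVec, map_add, map_smul, smul_eq_mul]
  have key : ∀ p q : ℝ, (0 < p → 0 ≤ q) → (p < 0 → q ≤ 0) → (p = 0 → q = 0) →
      (0 < p ↔ 0 < a * p + b * q) ∧ (p < 0 ↔ a * p + b * q < 0) := fun p q hp hn hz => by
    rcases lt_trichotomy p 0 with h | rfl | h
    · have h1 := mul_neg_of_pos_of_neg ha h
      have h2 := mul_nonpos_of_nonneg_of_nonpos hb (hn h)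
      exact ⟨by constructor <;> intro <;> linarith, by constructor <;> intro <;> linarith⟩
    · simp [hz rfl]
    · have h1 := mul_pos ha h
      have h2 := mul_nonneg hb (hp h)
      exact ⟨by constructor <;> intro <;> linarith, by constructor <;> intro <;> linarith⟩
  refine CSign.ofReal_eq_iff.2 ?_
  have k1 := key _ _ h1 h2 h3
  exact ⟨k1.1, k1.2, fun h0 => key _ _ (h4 h0) (h5 h0) (h6 h0)⟩

theorem signVec_smul (x : V) {a : ℝ} (ha : 0 < a) : signVec E (a • x) = signVec E x := by
  simpa using signVec_smul_add (E := E) (x := x) (y := 0) (signVec_zero_le _) ha le_rfl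

theorem signVec_add_le {x y : V} {σ : ι → CSign} {w : V} (hσ : signVec E w = σ)
    (hx : signVec E x ≤ σ) (hy : signVec E y ≤ σ) : signVec E (x + y) ≤ σ := by
  subst hσ
  intro i
  obtain ⟨h1, h2, h3, h4, h5, h6⟩ := CSign.ofReal_le_iff.1 (hx i)
  obtain ⟨k1, k2, k3, k4, k5, k6⟩ := CSign.ofReal_le_iff.1 (hy i)
  refine CSign.ofReal_le_iff.2 ?_
  simp only [map_add]
  exact ⟨fun h => add_nonneg (h1 h) (k1 h), fun h => add_nonpos (h2 h) (k2 h),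
    fun h => by rw [h3 h, k3 h, add_zero], fun h h' => add_nonneg (h4 h h') (k4 h h'),
    fun h h' => add_nonpos (h5 h h') (k5 h h'), fun h h' => by rw [h6 h h', k6 h h', add_zero]⟩

open Filter Topology in
theorem eventually_sign (a b : ℝ) :
    ∀ᶠ ε : ℝ in 𝓝[>] 0, (0 < a → 0 < a + ε * b) ∧ (a < 0 → a + ε * b < 0) ∧ 0 < ε := by
  have hc : Tendsto (fun ε : ℝ => a + ε * b) (𝓝[>] 0) (𝓝 a) := by
    have : Tendsto (fun ε : ℝ => a + ε * b) (𝓝 0) (𝓝 (a + 0 * b)) :=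
      Continuous.tendsto (by fun_prop) 0
    rw [zero_mul, add_zero] at this
    exact this.mono_left nhdsWithin_le_nhds
  have h1 : ∀ᶠ ε : ℝ in 𝓝[>] 0, 0 < a → 0 < a + ε * b := by
    by_cases h : 0 < a
    · filter_upwards [hc.eventually_const_lt h] with ε hε _ using hε
    · exact Eventually.of_forall fun _ h' => absurd h' h
  have h2 : ∀ᶠ ε : ℝ in 𝓝[>] 0, a < 0 → a + ε * b < 0 := by
    by_cases h : a < 0
    · filter_upwards [hc.eventually_lt_const h] with ε hε _ using hε
    · exact Eventually.of_forall fun _ h' => absurd h' h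
  filter_upwards [h1, h2, self_mem_nhdsWithin] with ε e1 e2 e3 using ⟨e1, e2, e3⟩

-- An open cone is relatively open in its flat. This is what allows small moves within a cone in all
-- later arguments.
open Filter Topology in
theorem eventually_signVec_eq [Finite ι] {x y : V} (hy : y ∈ flat E (signVec E x)) :
    ∀ᶠ ε : ℝ in 𝓝[>] 0, signVec E (x + ε • y) = signVec E x := by
  have h : ∀ i, ∀ᶠ ε : ℝ in 𝓝[>] 0, signVec E (x + ε • y) i = signVec E x i := fun i => by
    have hi := mem_flat_signVec.1 hy i
    filter_upwards [eventually_sign ((E i).1 x) ((E i).1 y),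
      eventually_sign ((E i).2 x) ((E i).2 y)] with ε h1 h2
    simp only [signVec, map_add, map_smul, smul_eq_mul]
    refine (CSign.ofReal_eq_iff.2 ?_).symm
    have key : ∀ p q : ℝ, (0 < p → 0 < p + ε * q) ∧ (p < 0 → p + ε * q < 0) ∧ 0 < ε →
        (p = 0 → q = 0) → (0 < p + ε * q ↔ 0 < p) ∧ (p + ε * q < 0 ↔ p < 0) := fun p q hp hz => by
      rcases lt_trichotomy p 0 with h | rfl | h
      · exact ⟨⟨fun h' => absurd h' (hp.2.1 h).not_gt, fun h' => absurd h' h.not_gt⟩,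
          ⟨fun _ => h, hp.2.1⟩⟩
      · simp [hz rfl]
      · exact ⟨⟨fun _ => h, hp.1⟩,
          ⟨fun h' => absurd h' (hp.1 h).not_gt, fun h' => absurd h' h.not_gt⟩⟩
    have k1 := key _ _ h1 hi.1
    refine ⟨k1.1, k1.2, fun h0 => ?_⟩
    have h0' : (E i).1 x = 0 := by
      rcases lt_trichotomy ((E i).1 x) 0 with h' | h' | h'
      · exact absurd h0 (k1.2.2 h').ne
      · exact h'
      · exact absurd h0 (k1.1.2 h').ne'
    exact key _ _ h2 (hi.2 h0')
  filter_upwards [eventually_all.2 h] with ε hε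
  exact funext hε

theorem exists_signVec_eq [Finite ι] {x y : V} (hy : y ∈ flat E (signVec E x)) :
    ∃ ε : ℝ, 0 < ε ∧ signVec E (x + ε • y) = signVec E x := by
  obtain ⟨ε, h1, h2⟩ := ((eventually_signVec_eq hy).and self_mem_nhdsWithin).exists
  exact ⟨ε, h2, h1⟩

/-! ### Localization at a point -/

/-- The stratification seen from a point `v`. -/
noncomputable def localize (E : ι → (V →ₗ[ℝ] ℝ) × (V →ₗ[ℝ] ℝ)) (v : V) : ι → (V →ₗ[ℝ] ℝ) × (V →ₗ[ℝ] ℝ) :=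
  fun i => if (E i).1 v ≠ 0 then (0, 0) else if (E i).2 v ≠ 0 then ((E i).1, 0) else E i

-- A small displacement cannot change a strict sign of v, and z decides only where v leaves freedom.
-- If only the second functional is nonzero at v, the first one of z may still override it, which is
-- why `localize` keeps it.
open Filter Topology in
theorem signVec_add_smul_eq_comp [Finite ι] (v z : V) : ∀ᶠ ε : ℝ in 𝓝[>] 0,
    signVec E (v + ε • z) = fun i => (signVec E v i).comp (signVec (localize E v) z i) := by
  have h : ∀ i, ∀ᶠ ε : ℝ in 𝓝[>] 0, signVec E (v + ε • z) i =
      (signVec E v i).comp (signVec (localize E v) z i) := fun i => by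
    filter_upwards [eventually_sign ((E i).1 v) ((E i).1 z),
      eventually_sign ((E i).2 v) ((E i).2 z)] with ε h1 h2
    have hε := h1.2.2
    simp only [signVec, localize, map_add, map_smul, smul_eq_mul]
    rcases lt_trichotomy ((E i).1 v) 0 with ha | ha | ha
    · have := h1.2.1 ha
      simp [CSign.ofReal, ha, ha.ne, ha.not_gt, this, this.not_gt, CSign.comp]
    · rcases lt_trichotomy ((E i).1 z) 0 with hb | hb | hb
      · have : ε * (E i).1 z < 0 := mul_neg_of_pos_of_neg hε hb
        rcases lt_trichotomy ((E i).2 v) 0 with hc | hc | hc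
        · simp [CSign.ofReal, ha, hb, hb.not_gt, this, this.not_gt, CSign.comp, hc, hc.not_gt, hc.ne]
        · simp [CSign.ofReal, ha, hb, hb.not_gt, this, this.not_gt, CSign.comp, hc]
        · simp [CSign.ofReal, ha, hb, hb.not_gt, this, this.not_gt, CSign.comp, hc, hc.ne']
      · rcases lt_trichotomy ((E i).2 v) 0 with hc | hc | hc
        · have := h2.2.1 hc
          simp [CSign.ofReal, ha, hb, this, this.not_gt, CSign.comp, hc, hc.not_gt, hc.ne]
        · simp [CSign.ofReal, ha, hb, CSign.comp, hc, mul_pos_iff_of_pos_left hε,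
            mul_neg_iff, hε, hε.not_gt]
        · have := h2.1 hc
          simp [CSign.ofReal, ha, hb, this, CSign.comp, hc, hc.ne']
      · have : 0 < ε * (E i).1 z := mul_pos hε hb
        rcases lt_trichotomy ((E i).2 v) 0 with hc | hc | hc
        · simp [CSign.ofReal, ha, hb, this, CSign.comp, hc, hc.not_gt, hc.ne]
        · simp [CSign.ofReal, ha, hb, this, CSign.comp, hc]
        · simp [CSign.ofReal, ha, hb, this, CSign.comp, hc, hc.ne']
    · have := h1.1 ha
      simp [CSign.ofReal, ha, ha.ne', this, CSign.comp]
  filter_upwards [eventually_all.2 h] with ε hε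
  exact funext hε

theorem signVec_localize_allowed (v z : V) (i : ι) :
    (signVec E v i).Allowed (signVec (localize E v) z i) = true := by
  have key : ∀ a : ℝ, ∀ b, (CSign.ofReal a 0 = b → b = CSign.zero ∨ b = CSign.pos ∨ b = CSign.neg) := by
    rintro a b rfl
    unfold CSign.ofReal
    split_ifs <;> simp_all
  simp only [signVec, localize]
  rcases lt_trichotomy ((E i).1 v) 0 with ha | ha | ha
  · simp [CSign.ofReal, ha, ha.ne, ha.not_gt, CSign.Allowed]
  · rcases lt_trichotomy ((E i).2 v) 0 with hc | hc | hc
    · have hs : CSign.ofReal 0 ((E i).2 v) = CSign.ineg := by simp [CSign.ofReal, hc, hc.not_gt]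
      rcases key ((E i).1 z) _ rfl with h | h | h <;>
      simp [ha, hc.ne, h, hs, CSign.Allowed]
    · simp [CSign.Allowed, CSign.ofReal, ha, hc]
    · have hs : CSign.ofReal 0 ((E i).2 v) = CSign.ipos := by simp [CSign.ofReal, hc]
      rcases key ((E i).1 z) _ rfl with h | h | h <;>
      simp [ha, hc.ne', h, hs, CSign.Allowed]
  · simp [CSign.ofReal, ha, ha.ne', CSign.Allowed]

end Data

/-! ### Cones in a half-space, stars and links -/

section Cells

variable {ι : Type*} {V : Type*} [AddCommGroup V] [Module ℝ V]

/-- The sign vectors of the cones through points of `W` on which `u` is positive (off the origin),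
including the zero cone. -/
def cells (E : ι → (V →ₗ[ℝ] ℝ) × (V →ₗ[ℝ] ℝ)) (u : V →ₗ[ℝ] ℝ) (W : Submodule ℝ V) :
    Set (ι → CSign) :=
  {σ | (∃ x ∈ W, signVec E x = σ) ∧ ∀ y, y ≠ 0 → signVec E y ≤ σ → 0 < u y}

/-- Only the origin lies in all subspaces of the stratification. -/
def Pointed (E : ι → (V →ₗ[ℝ] ℝ) × (V →ₗ[ℝ] ℝ)) : Prop :=
  ∀ x, signVec E x = signVec E 0 → x = 0

/-- The kernel of `u` contains the span of no nonzero cone. -/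
def GenPos (E : ι → (V →ₗ[ℝ] ℝ) × (V →ₗ[ℝ] ℝ)) (u : V →ₗ[ℝ] ℝ) : Prop :=
  ∀ x, x ≠ 0 → ∃ y ∈ flat E (signVec E x), u y ≠ 0

/-- No cone crosses the kernel of `l`. -/
def Compatible (E : ι → (V →ₗ[ℝ] ℝ) × (V →ₗ[ℝ] ℝ)) (l : V →ₗ[ℝ] ℝ) : Prop :=
  ∀ x y, signVec E y ≤ signVec E x → 0 ≤ l x * l y ∧ (l x = 0 → l y = 0)

/-- The functionals `u` and `l` are independent on the spans of the cones of dimension at least two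
that are not contained in the kernel of `l`. -/
def GenericPair (E : ι → (V →ₗ[ℝ] ℝ) × (V →ₗ[ℝ] ℝ)) (u l : V →ₗ[ℝ] ℝ) : Prop :=
  ∀ x, 2 ≤ rank E (signVec E x) → l x ≠ 0 → ∃ z ∈ flat E (signVec E x), l z = 0 ∧ u z ≠ 0

/-- The stratification induced on a subspace. -/
def restrictData (E : ι → (V →ₗ[ℝ] ℝ) × (V →ₗ[ℝ] ℝ)) (W : Submodule ℝ V) :
    ι → (W →ₗ[ℝ] ℝ) × (W →ₗ[ℝ] ℝ) :=
  fun i => ((E i).1.domRestrict W, (E i).2.domRestrict W)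

/-- The stratification seen from `v`, on the complement `ker u` of the line through `v`. -/
noncomputable def link (E : ι → (V →ₗ[ℝ] ℝ) × (V →ₗ[ℝ] ℝ)) (v : V) (u : V →ₗ[ℝ] ℝ) :
    ι → (LinearMap.ker u →ₗ[ℝ] ℝ) × (LinearMap.ker u →ₗ[ℝ] ℝ) :=
  restrictData (localize E v) (LinearMap.ker u)

variable {E : ι → (V →ₗ[ℝ] ℝ) × (V →ₗ[ℝ] ℝ)} {u l m : V →ₗ[ℝ] ℝ} {v : V}

theorem flat_restrictData (W : Submodule ℝ V) (σ : ι → CSign) :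
    flat (restrictData E W) σ = (flat E σ).comap W.subtype := rfl

theorem signVec_link (z : LinearMap.ker u) :
    signVec (link E v u) z = signVec (localize E v) (z : V) := rfl

theorem flat_comp (z : V) :
    flat E (fun i => (signVec E v i).comp (signVec (localize E v) z i)) =
      flat (localize E v) (signVec (localize E v) z) := by
  ext y
  rw [mem_flat_iff, mem_flat_iff]
  refine forall_congr' fun i => ?_
  have hall := signVec_localize_allowed (E := E) v z i
  rw [CSign.low_comp_iff hall, CSign.comp_eq_zero_iff]
  generalize signVec (localize E v) z i = τ
  simp only [signVec, CSign.low_ofReal_iff, CSign.ofReal_eq_zero_iff, localize]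
  split_ifs with h1 h2 <;> simp_all

theorem mem_flat_localize (z : V) : v ∈ flat (localize E v) (signVec (localize E v) z) := by
  rw [mem_flat_iff]
  intro i
  simp only [localize]
  split_ifs with h1 h2 <;> simp_all

theorem finrank_comap_ker [FiniteDimensional ℝ V] {L : Submodule ℝ V} (hv : v ∈ L)
    (huv : u v ≠ 0) :
    Module.finrank ℝ (L.comap (LinearMap.ker u).subtype) + 1 = Module.finrank ℝ L := by
  have hr : LinearMap.range (u.domRestrict L) = ⊤ := by
    refine LinearMap.range_eq_top.2 fun c => ⟨(c / u v) • ⟨v, hv⟩, ?_⟩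
    rw [map_smul, LinearMap.domRestrict_apply, smul_eq_mul, div_mul_cancel₀ _ huv]
  have h := LinearMap.finrank_range_add_finrank_ker (u.domRestrict L)
  rw [hr, finrank_top, Module.finrank_self] at h
  have h1 : (L.comap (LinearMap.ker u).subtype).map (LinearMap.ker u).subtype =
      (LinearMap.ker (u.domRestrict L)).map L.subtype := by
    ext x
    simp only [Submodule.mem_map, Submodule.mem_comap, Submodule.subtype_apply, Subtype.exists,
      LinearMap.mem_ker, LinearMap.domRestrict_apply]
    constructor
    · rintro ⟨a, ha, hL, rfl⟩
      exact ⟨a, hL, ha, rfl⟩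
    · rintro ⟨a, ha, hL, rfl⟩
      exact ⟨a, hL, ha, rfl⟩
  rw [← Submodule.finrank_map_subtype_eq, h1, Submodule.finrank_map_subtype_eq]
  omega

/-- The span of a cone at v contains v, so cutting it with the complement `ker u` of the line
through v loses exactly one dimension. -/
theorem rank_comp [FiniteDimensional ℝ V] (huv : u v ≠ 0) (z : LinearMap.ker u) :
    rank E (fun i => (signVec E v i).comp (signVec (link E v u) z i)) =
      rank (link E v u) (signVec (link E v u) z) + 1 := by
  rw [rank, signVec_link, flat_comp, rank, link, flat_restrictData,
    finrank_comap_ker (mem_flat_localize _) huv]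

theorem eq_smul_of_rank_eq_one [FiniteDimensional ℝ V] (hv : rank E (signVec E v) = 1)
    (hv0 : v ≠ 0) {y : V} (hy : y ∈ flat E (signVec E v)) : ∃ c : ℝ, c • v = y := by
  have h := (finrank_eq_one_iff_of_nonzero' (⟨v, self_mem_flat v⟩ : flat E (signVec E v))
    (by simpa [Subtype.ext_iff] using hv0)).1 hv ⟨y, hy⟩
  obtain ⟨c, hc⟩ := h
  exact ⟨c, congrArg Subtype.val hc⟩

open Filter Topology in
theorem exists_add_smul_eq_comp [Finite ι] (v z : V) {a b : ℝ} (ha : 0 < a) :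
    ∃ ε : ℝ, 0 < ε ∧ 0 < a + ε * b ∧
      signVec E (v + ε • z) = fun i => (signVec E v i).comp (signVec (localize E v) z i) := by
  obtain ⟨ε, h1, h2⟩ := ((signVec_add_smul_eq_comp (E := E) v z).and (eventually_sign a b)).exists
  exact ⟨ε, h2.2.2, h2.1 ha, h1⟩

/-- If z had zero sign in the link, v + εz would lie in the cone of v, which is a ray; comparing
values of u gives z = 0. -/
theorem link_pointed [Finite ι] [FiniteDimensional ℝ V] (hv : rank E (signVec E v) = 1)
    (huv : u v ≠ 0) : Pointed (link E v u) := by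
  intro z hz
  obtain ⟨ε, hε, -, h⟩ := exists_add_smul_eq_comp (E := E) v (z : V) (b := 0) one_pos
  rw [signVec_zero, signVec_link] at hz
  have h1 : signVec E (v + ε • (z : V)) = signVec E v := by
    rw [h, hz]
    funext i
    show (signVec E v i).comp CSign.zero = _
    cases signVec E v i <;> rfl
  have h2 : v + ε • (z : V) ∈ flat E (signVec E v) := h1 ▸ self_mem_flat _
  have hv0 : v ≠ 0 := fun h => huv (by rw [h, map_zero])
  obtain ⟨c, hc⟩ := eq_smul_of_rank_eq_one hv hv0 h2
  have hz0 : u (z : V) = 0 := z.2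
  have h3 := congrArg u hc
  rw [map_add, map_smul, map_smul, hz0, smul_zero, add_zero, smul_eq_mul] at h3
  have hc1 : c = 1 := mul_right_cancel₀ huv (by rw [h3, one_mul])
  rw [hc1, one_smul, left_eq_add, smul_eq_zero] at hc
  exact Subtype.ext (hc.resolve_left hε.ne')

theorem rank_pos [FiniteDimensional ℝ V] {x : V} (hx : x ≠ 0) : 0 < rank E (signVec E x) := by
  have : Nontrivial (flat E (signVec E x)) :=
    ⟨⟨⟨x, self_mem_flat x⟩, 0, by simpa [Subtype.ext_iff] using hx⟩⟩
  exact Module.finrank_pos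

theorem comp_mono_link (z z' : LinearMap.ker u) :
    ((fun i => (signVec E v i).comp (signVec (link E v u) z i)) ≤
      fun i => (signVec E v i).comp (signVec (link E v u) z' i)) ↔
    signVec (link E v u) z ≤ signVec (link E v u) z' :=
  forall_congr' fun i => CSign.comp_le_comp_iff (signVec_localize_allowed v _ i)
    (signVec_localize_allowed v _ i)

/-- The cones at `v` below the level of `v` are the cones of the link in an open half-space. -/
theorem star_eq_image [Finite ι] [FiniteDimensional ℝ V] (hE : Pointed E)
    (huv : 0 < u v) (hmv : 0 < m v)
    (hm : ∀ x, signVec E v ≤ signVec E x → ∀ y, signVec E y ≤ signVec E x → 0 ≤ m y)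
    (hgen : ∀ x, signVec E v ≤ signVec E x → 2 ≤ rank E (signVec E x) →
      ∃ z ∈ flat E (signVec E x), m z = 0 ∧ u z ≠ 0) :
    {σ | (∃ x, signVec E x = σ) ∧ signVec E v ≤ σ ∧ ∀ y, y ≠ 0 → signVec E y ≤ σ →
      0 < u y ∧ m y * u v ≤ m v * u y} =
    (fun τ i => (signVec E v i).comp (τ i)) ''
      cells (link E v u) (-(m.domRestrict (LinearMap.ker u))) ⊤ := by
  have hv0 : v ≠ 0 := fun h => huv.ne' (by rw [h, map_zero])
  have hle : ∀ z : V, signVec E v ≤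
      fun i => (signVec E v i).comp (signVec (localize E v) z i) :=
    fun z i => CSign.le_comp _ _
  ext σ
  constructor
  · rintro ⟨⟨x, rfl⟩, hvx, hσ⟩
    have hx0 : x ≠ 0 := by
      rintro rfl
      exact hv0 (hE v (le_antisymm hvx (signVec_zero_le _)))
    have hux := (hσ x hx0 le_rfl).1
    -- Rescale x to the slice where u takes the value u v, and take the displacement from v.
    let z : LinearMap.ker u := ⟨(u v / u x) • x - v, by
      rw [LinearMap.mem_ker, map_sub, map_smul, smul_eq_mul, div_mul_cancel₀ _ hux.ne', sub_self]⟩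
    have hz : (fun i => (signVec E v i).comp (signVec (link E v u) z i)) = signVec E x := by
      obtain ⟨ε, hε, hε1, h⟩ := exists_add_smul_eq_comp (E := E) v (z : V) (b := -1) one_pos
      rw [signVec_link, ← h]
      have : v + ε • ((u v / u x) • x - v) = (ε * (u v / u x)) • x + (1 + ε * -1) • v := by
        module
      show signVec E (v + ε • ((u v / u x) • x - v)) = _
      rw [this]
      exact signVec_smul_add hvx (by positivity) hε1.le
    refine ⟨signVec (link E v u) z, ⟨⟨z, trivial, rfl⟩, fun z' hz' hle' => ?_⟩, hz⟩
    obtain ⟨ε, hε, -, h⟩ := exists_add_smul_eq_comp (E := E) v (z' : V) (b := 0) one_pos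
    have hy : signVec E (v + ε • (z' : V)) ≤ signVec E x := by
      rw [← hz, h]
      exact (comp_mono_link z' z).2 hle'
    have huz' : u (z' : V) = 0 := z'.2
    have huy : u (v + ε • (z' : V)) = u v := by rw [map_add, map_smul, huz', smul_zero, add_zero]
    have hy0 : v + ε • (z' : V) ≠ 0 := fun h0 => by rw [h0, map_zero] at huy; exact huv.ne huy
    have h1 := (hσ _ hy0 hy).2
    rw [huy] at h1
    have h2 : m (v + ε • (z' : V)) ≤ m v := le_of_mul_le_mul_right h1 huv
    have h2' := h2
    rw [map_add, map_smul, smul_eq_mul] at h2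
    have h3 : m (z' : V) ≤ 0 := by
      by_contra hcon
      have := mul_pos hε (not_le.1 hcon)
      linarith
    rcases h3.lt_or_eq with h4 | h4
    · simpa using h4
    exfalso
    -- If m vanished at z', a point with the same ratio m/u as v would lie in a cone of rank at
    -- least two. Moving it inside that cone with m constant and u decreasing would exceed the
    -- maximal ratio.
    have hrank : 2 ≤ rank E (signVec E (v + ε • (z' : V))) := by
      rw [h]
      have h5 := rank_comp (E := E) huv.ne' z'
      have h6 := rank_pos (E := link E v u) hz'
      rw [signVec_link] at h5 h6
      omega
    obtain ⟨w, hw, hmw, huw⟩ := hgen _ (h ▸ hle _) hrank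
    have key : ∀ w ∈ flat E (signVec E (v + ε • (z' : V))), m w = 0 → ¬ u w < 0 := by
      intro w hw hmw huw
      obtain ⟨δ, hδ, hs⟩ := exists_signVec_eq hw
      have h5 : v + ε • (z' : V) + δ • w ≠ 0 := by
        intro h0
        have := congrArg m h0
        rw [map_add, map_smul, hmw, smul_zero, add_zero, map_add, map_smul, h4, smul_zero,
          add_zero, map_zero] at this
        exact hmv.ne' this
      have h6 := (hσ _ h5 (hs ▸ hy)).2
      rw [map_add, map_smul, hmw, smul_zero, add_zero, map_add m, map_smul, h4, smul_zero, add_zero,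
        map_add, huy, map_smul, smul_eq_mul] at h6
      have h7 := le_of_mul_le_mul_left h6 hmv
      have := mul_neg_of_pos_of_neg hδ huw
      linarith
    rcases lt_or_gt_of_ne huw with h5 | h5
    · exact key w hw hmw h5
    · exact key (-w) (neg_mem hw) (by rw [map_neg, hmw, neg_zero]) (by rw [map_neg]; linarith)
  · rintro ⟨_, ⟨⟨z, -, rfl⟩, hτ⟩, rfl⟩
    obtain ⟨ε, hε, -, h⟩ := exists_add_smul_eq_comp (E := E) v (z : V) (b := 0) one_pos
    have hσ : signVec E (v + ε • (z : V)) =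
      fun i => (signVec E v i).comp (signVec (link E v u) z i) := h
    refine ⟨⟨_, h⟩, hle _, fun y hy0 hy => ?_⟩
    -- The component of y in `ker u` along v. It lies in the closed link cone, so either it vanishes
    -- or -m is positive on it.
    let z' : LinearMap.ker u := ⟨y - (u y / u v) • v, by
      rw [LinearMap.mem_ker, map_sub, map_smul, smul_eq_mul, div_mul_cancel₀ _ huv.ne', sub_self]⟩
    have hz' : signVec (link E v u) z' ≤ signVec (link E v u) z := by
      rw [← comp_mono_link, ← hσ]
      obtain ⟨η, hη, hη1, h'⟩ := exists_add_smul_eq_comp (E := E) v (z' : V)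
        (b := -(u y / u v)) one_pos
      rw [signVec_link, ← h']
      have : v + η • (y - (u y / u v) • v) = (1 + η * -(u y / u v)) • v + η • y := by module
      show signVec E (v + η • (y - (u y / u v) • v)) ≤ _
      rw [this]
      refine signVec_add_le rfl ?_ ?_
      · rw [signVec_smul _ hη1, h]
        exact hle _
      · rw [signVec_smul _ hη]
        exact h ▸ hy
    have hmy : 0 ≤ m y := hm (v + ε • (z : V)) (h ▸ hle _) y (h ▸ hy)
    have h1 : z' ≠ 0 → m y - (u y / u v) * m v < 0 := fun h0 => by
      have := hτ z' h0 hz'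
      simpa [z'] using this
    have h2 : m y * u v ≤ m v * u y := by
      by_cases h0 : z' = 0
      · have : y - (u y / u v) • v = 0 := congrArg Subtype.val h0
        have := congrArg m this
        rw [map_sub, map_smul, map_zero, smul_eq_mul, sub_eq_zero] at this
        rw [this]
        field_simp
        exact le_rfl
      · have := mul_lt_mul_of_pos_right (h1 h0) huv
        have h3 : (m y - (u y / u v) * m v) * u v = m y * u v - m v * u y := by field_simp
        rw [h3] at this
        linarith
    refine ⟨?_, h2⟩
    have h3 : 0 ≤ u y := by
      by_contra hcon
      have h4 := mul_neg_of_pos_of_neg hmv (not_le.1 hcon)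
      have h5 := mul_nonneg hmy huv.le
      linarith
    rcases h3.lt_or_eq with h4 | h4
    · exact h4
    exfalso
    -- When u y = 0 this component is y itself, and -m > 0 there contradicts m y ≥ 0.
    have h5 : z' ≠ 0 := fun h0 => by
      have : y - (u y / u v) • v = 0 := congrArg Subtype.val h0
      rw [← h4, zero_div, zero_smul, sub_zero] at this
      exact hy0 this
    have := h1 h5
    rw [← h4, zero_div, zero_mul, sub_zero] at this
    linarith

end Cells

/-! ### Sweeping the vertices by the ratio |l|/u -/

section Sweep

variable {ι : Type*} {V : Type*} [NormedAddCommGroup V] [NormedSpace ℝ V] [FiniteDimensional ℝ V]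
variable {E : ι → (V →ₗ[ℝ] ℝ) × (V →ₗ[ℝ] ℝ)} {u l : V →ₗ[ℝ] ℝ} {v : V}

theorem isClosed_signVec_le (x : V) : IsClosed {y | signVec E y ≤ signVec E x} := by
  have himp : ∀ (P : Prop) (s : Set V), IsClosed s → IsClosed {y | P → y ∈ s} := fun P s hs => by
    by_cases hP : P
    · simpa [hP] using hs
    · simp [hP]
  have : {y | signVec E y ≤ signVec E x} = ⋂ i, {y | signVec E y i ≤ signVec E x i} := by
    ext y
    simp only [Set.mem_iInter, Set.mem_ofPred_eq]
    rfl
  rw [this]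
  refine isClosed_iInter fun i => ?_
  simp only [signVec, CSign.ofReal_le_iff]
  have c1 : Continuous (E i).1 := LinearMap.continuous_of_finiteDimensional _
  have c2 : Continuous (E i).2 := LinearMap.continuous_of_finiteDimensional _
  have g1 := isClosed_le (continuous_const (y := (0 : ℝ))) c1
  have n1 := isClosed_le c1 (continuous_const (y := (0 : ℝ)))
  have z1 := isClosed_eq c1 (continuous_const (y := (0 : ℝ)))
  have g2 := isClosed_le (continuous_const (y := (0 : ℝ))) c2
  have n2 := isClosed_le c2 (continuous_const (y := (0 : ℝ)))
  have z2 := isClosed_eq c2 (continuous_const (y := (0 : ℝ)))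
  exact (himp _ _ g1).inter ((himp _ _ n1).inter ((himp _ _ z1).inter
    ((himp _ _ (himp _ _ g2)).inter ((himp _ _ (himp _ _ n2)).inter (himp _ _ (himp _ _ z2))))))

theorem isCompact_sphere_inter {S : Set (ι → CSign)} (hS : S.Finite)
    (hpt : ∀ σ ∈ S, ∃ x, signVec E x = σ)
    (hdown : ∀ σ ∈ S, ∀ y, signVec E y ≤ σ → signVec E y ∈ S) :
    IsCompact {y : V | ‖y‖ = 1 ∧ signVec E y ∈ S} := by
  have h1 : {y : V | ‖y‖ = 1 ∧ signVec E y ∈ S} =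
      Metric.sphere 0 1 ∩ ⋃ σ ∈ S, {y | signVec E y ≤ σ} := by
    ext y
    simp only [Set.mem_ofPred_eq, Set.mem_inter_iff, mem_sphere_zero_iff_norm, Set.mem_iUnion,
      exists_prop]
    exact and_congr_right fun _ => ⟨fun h => ⟨_, h, le_rfl⟩, fun ⟨σ, hσ, h⟩ => hdown σ hσ y h⟩
  rw [h1]
  refine (isCompact_sphere 0 1).inter_right (hS.isClosed_biUnion fun σ hσ => ?_)
  obtain ⟨x, rfl⟩ := hpt σ hσ
  exact isClosed_signVec_le x

omit [FiniteDimensional ℝ V] in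
theorem cells_downward {W : Submodule ℝ V} {σ : ι → CSign} (hσ : σ ∈ cells E u W) {y : V}
    (hW : ∀ x ∈ W, flat E (signVec E x) ≤ W)
    (hy : signVec E y ≤ σ) : signVec E y ∈ cells E u W := by
  obtain ⟨⟨x, hx, rfl⟩, h⟩ := hσ
  exact ⟨⟨y, hW x hx (mem_flat_of_le hy), rfl⟩, fun z hz hzy => h z hz (hzy.trans hy)⟩

omit [FiniteDimensional ℝ V] in
theorem Compatible.flat_le [Finite ι] (hl : Compatible E l) {x : V} (hx : l x = 0) :
    flat E (signVec E x) ≤ LinearMap.ker l := by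
  intro y hy
  obtain ⟨ε, hε, h⟩ := exists_signVec_eq hy
  have := (hl x _ h.le).2 hx
  rw [map_add, hx, zero_add, map_smul, smul_eq_mul, mul_eq_zero] at this
  exact this.resolve_left hε.ne'

/-- The ratio |l|/u is invariant under positive scaling, and the unit vectors in the cones of a
downward closed set form a compact set. The inequality is multiplied out to avoid division. -/
theorem exists_max_ratio [Finite ι] {S : Set (ι → CSign)}
    (hS : S ⊆ cells E u ⊤)
    (hdown : ∀ σ ∈ S, ∀ y, signVec E y ≤ σ → signVec E y ∈ S)
    {y₀ : V} (hy₀ : signVec E y₀ ∈ S) (hl₀ : l y₀ ≠ 0) :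
    ∃ v, v ≠ 0 ∧ signVec E v ∈ S ∧ l v ≠ 0 ∧
      ∀ y, y ≠ 0 → signVec E y ∈ S → |l y| * u v ≤ |l v| * u y := by
  have hpos : ∀ y, y ≠ 0 → signVec E y ∈ S → 0 < u y := fun y h0 hy => (hS hy).2 y h0 le_rfl
  have hne : ∀ y : V, ‖y‖ = 1 → y ≠ 0 := fun y hy h => by
    rw [h, norm_zero] at hy
    exact zero_ne_one hy
  have hnorm : ∀ y : V, y ≠ 0 → ‖(‖y‖⁻¹ : ℝ) • y‖ = 1 := fun y hy => by
    rw [norm_smul, norm_inv, norm_norm, inv_mul_cancel₀ (norm_ne_zero_iff.2 hy)]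
  have hmem : ∀ y : V, y ≠ 0 → signVec E y ∈ S →
      (‖y‖⁻¹ : ℝ) • y ∈ {y : V | ‖y‖ = 1 ∧ signVec E y ∈ S} := fun y h0 hy =>
    ⟨hnorm y h0, by rwa [signVec_smul _ (inv_pos.2 (norm_pos_iff.2 h0))]⟩
  have hy00 : y₀ ≠ 0 := fun h => hl₀ (by rw [h, map_zero])
  have cu : Continuous u := LinearMap.continuous_of_finiteDimensional u
  have cl : Continuous l := LinearMap.continuous_of_finiteDimensional l
  obtain ⟨v, hv, hmax⟩ := (isCompact_sphere_inter (E := E) (Set.toFinite S)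
    (fun σ hσ => (hS hσ).1.imp fun x hx => hx.2) hdown).exists_isMaxOn
    ⟨_, hmem y₀ hy00 hy₀⟩ (f := fun y => |l y| / u y)
    (ContinuousOn.div cl.abs.continuousOn cu.continuousOn
      fun y hy => (hpos y (hne y hy.1) hy.2).ne')
  have hmax' : ∀ y, y ≠ 0 → signVec E y ∈ S → |l y| * u v ≤ |l v| * u y := fun y h0 hy => by
    have h1 := hmax (hmem y h0 hy)
    have h2 := inv_pos.2 (norm_pos_iff.2 h0)
    have h3 := hpos v (hne v hv.1) hv.2
    have h4 := hpos y h0 hy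
    simp only [map_smul, smul_eq_mul, abs_mul, abs_of_pos h2, Set.mem_ofPred_eq] at h1
    rw [mul_div_mul_left _ _ h2.ne', div_le_div_iff₀ h4 h3] at h1
    exact h1
  refine ⟨v, hne v hv.1, hv.2, fun h0 => ?_, hmax'⟩
  have h1 := hmax' y₀ hy00 hy₀
  rw [h0, abs_zero, zero_mul] at h1
  have := mul_pos (abs_pos.2 hl₀) (hpos v (hne v hv.1) hv.2)
  linarith

/-- Removing the vertices in decreasing order of `|l| / u` collapses the cones on which `u` is
positive to those in the kernel of `l`, if the links are removable. -/
theorem sweep [Finite ι] (hE : Pointed E) (hl : Compatible E l) (hgen : GenericPair E u l)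
    {Q : (ι → CSign) → (ι → CSign) → Prop}
    (hlink : ∀ v, 0 < u v → l v ≠ 0 → rank E (signVec E v) = 1 →
      Coll (fun τ τ' => Q (fun i => (signVec E v i).comp (τ i))
        (fun i => (signVec E v i).comp (τ' i)))
        (cells (link E v u) (-((l v • l).domRestrict (LinearMap.ker u))) ⊤) ∅) :
    Coll Q (cells E u ⊤) (cells E u (LinearMap.ker l)) := by
  -- Invariant for the remaining set S: it is downward closed, contains the target, and every
  -- removed cell has a removed face on which some ratio is at least all ratios still occurring in
  -- S.
  suffices H : ∀ n, ∀ S : Set (ι → CSign), S.ncard = n → S ⊆ cells E u ⊤ →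
      (∀ σ ∈ S, ∀ y, signVec E y ≤ σ → signVec E y ∈ S) → cells E u (LinearMap.ker l) ⊆ S →
      (∀ σ ∈ cells E u ⊤, σ ∉ S → ∃ y, y ≠ 0 ∧ signVec E y ≤ σ ∧ signVec E y ∉ S ∧
        ∀ y', y' ≠ 0 → signVec E y' ∈ S → |l y'| * u y ≤ |l y| * u y') →
      Coll Q S (cells E u (LinearMap.ker l)) from
    H _ _ rfl subset_rfl (fun σ hσ y hy => cells_downward hσ (fun _ _ => le_top) hy)
      (fun σ hσ => ⟨hσ.1.imp fun x hx => ⟨trivial, hx.2⟩, hσ.2⟩) (fun σ h h' => absurd h h')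
  intro n
  induction n using Nat.strong_induction_on with
  | _ n ih =>
  intro S hn hS hdown hker hrem
  by_cases hall : ∀ y, signVec E y ∈ S → l y = 0
  · have : S = cells E u (LinearMap.ker l) := by
      refine Set.Subset.antisymm (fun σ hσ => ?_) hker
      obtain ⟨⟨x, -, rfl⟩, h⟩ := hS hσ
      exact ⟨⟨x, hall x hσ, rfl⟩, h⟩
    rw [this]
    exact Relation.ReflTransGen.refl
  push Not at hall
  obtain ⟨y₀, hy₀, hl₀⟩ := hall
  obtain ⟨v, hv0, hvS, hlv, hmax⟩ := exists_max_ratio hS hdown hy₀ hl₀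
  have hpos : ∀ y, y ≠ 0 → signVec E y ∈ S → 0 < u y := fun y h0 hy => (hS hy).2 y h0 le_rfl
  have huv := hpos v hv0 hvS
  -- a maximum of the ratio is attained in a cone of dimension one
  have hmaxrank : ∀ y, 0 < u y →
      (∀ y', y' ≠ 0 → signVec E y' ≤ signVec E y → |l y'| * u v ≤ |l v| * u y') →
      |l y| * u v = |l v| * u y → rank E (signVec E y) = 1 := by
    intro y huy hy heq
    have h1 := rank_pos (E := E) (x := y) fun h => huy.ne' (by rw [h, map_zero])
    by_contra hne
    have hly : l y ≠ 0 := fun h0 => by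
      rw [h0, abs_zero, zero_mul] at heq
      exact (mul_pos (abs_pos.2 hlv) huy).ne heq
    -- In rank at least two, genericity gives a direction keeping l fixed and decreasing u, so the
    -- ratio could still grow.
    obtain ⟨z, hz, hlz, huz⟩ := hgen y (by omega) hly
    have key : ∀ z ∈ flat E (signVec E y), l z = 0 → ¬ u z < 0 := by
      intro z hz hlz huz
      obtain ⟨δ, hδ, hs⟩ := exists_signVec_eq hz
      have hl' : l (y + δ • z) = l y := by rw [map_add, map_smul, hlz, smul_zero, add_zero]
      have h2 := hy (y + δ • z) (fun h0 => hly (by rw [← hl', h0, map_zero])) hs.le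
      rw [hl', heq, map_add, map_smul, smul_eq_mul] at h2
      have h3 := le_of_mul_le_mul_left h2 (abs_pos.2 hlv)
      have := mul_neg_of_pos_of_neg hδ huz
      linarith
    rcases lt_or_gt_of_ne huz with h5 | h5
    · exact key z hz hlz h5
    · exact key (-z) (neg_mem hz) (by rw [map_neg, hlz, neg_zero]) (by rw [map_neg]; linarith)
  have hvrank := hmaxrank v huv (fun y h0 hy => hmax y h0 (hdown _ hvS y hy)) rfl
  have hlsgn : ∀ x, signVec E v ≤ signVec E x → ∀ y, signVec E y ≤ signVec E x →
      0 ≤ l v * l y := by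
    intro x hvx y hyx
    have h1 := (hl x v hvx)
    have h2 := (hl x y hyx)
    have hx : l x ≠ 0 := fun h => hlv (h1.2 h)
    have h3 : 0 < l x * l v := lt_of_le_of_ne h1.1 (mul_ne_zero hx hlv).symm
    rcases lt_or_gt_of_ne hx with h | h
    · have h4 : l v < 0 := by nlinarith
      have h5 : l y ≤ 0 := by nlinarith [h2.1]
      exact mul_nonneg_of_nonpos_of_nonpos h4.le h5
    · have h4 : 0 < l v := by nlinarith
      have h5 : 0 ≤ l y := by nlinarith [h2.1]
      exact mul_nonneg h4.le h5
  have hstar := star_eq_image (E := E) (u := u) (m := l v • l) (v := v) hE huv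
    (by simpa using hlv) (fun x hvx y hyx => by simpa using hlsgn x hvx y hyx)
    (fun x hvx hr => by
      obtain ⟨z, hz, h1, h2⟩ := hgen x hr fun h => hlv ((hl x v hvx).2 h)
      exact ⟨z, hz, by simp [h1], h2⟩)
  -- The geometric star cut off at the ratio of v is exactly the part of S above v. The factor l v
  -- in m fixes the sign of l on this star, turning absolute values into a linear condition.
  have hstarS : {σ | (∃ x, signVec E x = σ) ∧ signVec E v ≤ σ ∧ ∀ y, y ≠ 0 → signVec E y ≤ σ →
      0 < u y ∧ (l v • l) y * u v ≤ (l v • l) v * u y} = {σ | σ ∈ S ∧ signVec E v ≤ σ} := by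
    have habs : ∀ x, signVec E v ≤ signVec E x → ∀ y, signVec E y ≤ signVec E x →
        ((l v • l) y * u v ≤ (l v • l) v * u y ↔ |l y| * u v ≤ |l v| * u y) := by
      intro x hvx y hyx
      have h1 := hlsgn x hvx y hyx
      have h2 : l v * l y = |l v| * |l y| := by rw [← abs_mul, abs_of_nonneg h1]
      simp only [LinearMap.smul_apply, smul_eq_mul]
      rw [h2, ← abs_mul_abs_self (l v), mul_assoc, mul_assoc]
      exact mul_le_mul_iff_right₀ (abs_pos.2 hlv)
    ext σ
    constructor
    · rintro ⟨⟨x, rfl⟩, hvx, h⟩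
      refine ⟨?_, hvx⟩
      by_contra hxS
      obtain ⟨y, hy0, hyx, hyS, hy⟩ := hrem _ ⟨⟨x, trivial, rfl⟩, fun y h0 hy => (h y h0 hy).1⟩ hxS
      have h1 := hy v hv0 hvS
      have h2 := (habs x hvx y hyx).1 (h y hy0 hyx).2
      -- A removed face y of such a cell would tie with v. Then v + εy also attains the maximum, so
      -- it lies on a ray; hence y and v lie on the same ray, although one is removed and the other
      -- is not.
      have heq : |l y| * u v = |l v| * u y := le_antisymm h2 h1
      have huy := (h y hy0 hyx).1
      obtain ⟨ε, hε, -, hcomp⟩ := exists_add_smul_eq_comp (E := E) v y (b := 0) one_pos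
      have hvw : signVec E v ≤ signVec E (v + ε • y) := by
        rw [hcomp]
        exact fun i => CSign.le_comp _ _
      have hwx : signVec E (v + ε • y) ≤ signVec E x :=
        signVec_add_le rfl hvx (by rwa [signVec_smul _ hε])
      have hlw : |l (v + ε • y)| = |l v| + ε * |l y| := by
        have h1 := hlsgn x hvx y hyx
        rw [map_add, map_smul, smul_eq_mul, ← abs_of_pos hε, ← abs_mul, abs_of_pos hε]
        refine abs_add_eq_add_abs_iff _ _ |>.2 ?_
        rcases lt_or_gt_of_ne hlv with h' | h'
        · exact Or.inr ⟨h'.le, mul_nonpos_of_nonneg_of_nonpos hε.le (by nlinarith)⟩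
        · exact Or.inl ⟨h'.le, mul_nonneg hε.le (by nlinarith)⟩
      have huw : u (v + ε • y) = u v + ε * u y := by rw [map_add, map_smul, smul_eq_mul]
      have hw0 : v + ε • y ≠ 0 := fun h0 => by
        rw [h0, map_zero] at huw
        have := mul_pos hε huy
        linarith
      have hwrank : rank E (signVec E (v + ε • y)) = 1 := by
        refine hmaxrank _ (h _ hw0 hwx).1 (fun y' h0 hy' => ?_) ?_
        · exact (habs x hvx y' (hy'.trans hwx)).1 (h y' h0 (hy'.trans hwx)).2
        · rw [hlw, huw, add_mul, mul_add, mul_assoc, heq]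
          ring
      have hvf := mem_flat_of_le hvw
      have hyf : y ∈ flat E (signVec E (v + ε • y)) := by
        have h1 := sub_mem (self_mem_flat (E := E) (v + ε • y)) hvf
        rw [add_sub_cancel_left] at h1
        exact (Submodule.smul_mem_iff _ hε.ne').1 h1
      obtain ⟨a, ha⟩ := eq_smul_of_rank_eq_one hwrank hw0 hvf
      obtain ⟨b, hb⟩ := eq_smul_of_rank_eq_one hwrank hw0 hyf
      have huw0 := (h _ hw0 hwx).1
      have ha0 : 0 < a := by
        have := congrArg u ha
        rw [map_smul, smul_eq_mul] at this
        exact pos_of_mul_pos_left (this ▸ huv) huw0.le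
      have hb0 : 0 < b := by
        have := congrArg u hb
        rw [map_smul, smul_eq_mul] at this
        exact pos_of_mul_pos_left (this ▸ huy) huw0.le
      have h1 : signVec E v = signVec E (v + ε • y) := by
        conv_lhs => rw [← ha, signVec_smul _ ha0]
      have h2 : signVec E y = signVec E (v + ε • y) := by
        conv_lhs => rw [← hb, signVec_smul _ hb0]
      exact hyS (h2.trans h1.symm ▸ hvS)
    · rintro ⟨hσS, hvσ⟩
      obtain ⟨⟨x, -, rfl⟩, hx⟩ := hS hσS
      refine ⟨⟨x, rfl⟩, hvσ, fun y hy0 hyx => ⟨hx y hy0 hyx, (habs x hvσ y hyx).2 ?_⟩⟩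
      exact hmax y hy0 (hdown _ hσS y hyx)
  rw [hstar] at hstarS
  have hdecomp : S = {σ | σ ∈ S ∧ ¬ signVec E v ≤ σ} ∪ {σ | σ ∈ S ∧ signVec E v ≤ σ} := by
    ext σ
    simp only [Set.mem_union, Set.mem_ofPred_eq]
    tauto
  have hstep := (hlink v huv hlv hvrank).image (f := fun (τ : ι → CSign) i => (signVec E v i).comp (τ i))
    (B := {σ | σ ∈ S ∧ ¬ signVec E v ≤ σ})
    (by
      rintro _ ⟨⟨z, -, rfl⟩, -⟩ _ ⟨⟨z', -, rfl⟩, -⟩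
      exact comp_mono_link z z')
    (by
      rintro τ - b ⟨-, hb⟩ hτb
      exact hb (le_trans (fun i => CSign.le_comp _ _) hτb))
  rw [hstarS, ← hdecomp, Set.image_empty, Set.union_empty] at hstep
  refine Relation.ReflTransGen.trans hstep (ih _ ?_ _ rfl (fun σ hσ => hS hσ.1) ?_ ?_ ?_)
  · rw [← hn]
    refine Set.ncard_lt_ncard ⟨fun σ hσ => hσ.1, fun h => ?_⟩ (Set.toFinite S)
    exact (h hvS).2 le_rfl
  · rintro σ ⟨hσ, hvσ⟩ y hy
    exact ⟨hdown σ hσ y hy, fun h => hvσ (h.trans hy)⟩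
  · rintro σ hσ
    refine ⟨hker hσ, fun hvσ => ?_⟩
    obtain ⟨⟨x, hx, rfl⟩, -⟩ := hσ
    exact hlv ((hl x v hvσ).2 hx)
  · intro σ hσ hσS
    by_cases h : σ ∈ S
    · have hvσ : signVec E v ≤ σ := by
        by_contra hcon
        exact hσS ⟨h, hcon⟩
      exact ⟨v, hv0, hvσ, fun h' => h'.2 le_rfl, fun y' h0 hy' => hmax y' h0 hy'.1⟩
    · obtain ⟨y, h1, h2, h3, h4⟩ := hrem σ hσ h
      exact ⟨y, h1, h2, fun h' => h3 h'.1, fun y' h0 hy' => h4 y' h0 hy'.1⟩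

open Filter Topology in
/-- A functional in general position can be made generic without changing the cones on which it
is positive. -/
theorem exists_genericPair [Finite ι] (hu : GenPos E u) (l : V →ₗ[ℝ] ℝ) :
    ∃ u' : V →ₗ[ℝ] ℝ, GenPos E u' ∧ GenericPair E u' l ∧ ∀ W, cells E u' W = cells E u W := by
  classical
  -- One witness in flat ∩ ker l per sign vector suffices. There are finitely many, so some
  -- functional g is nonzero on all of them, and u is perturbed along g.
  let P : (ι → CSign) → V → Prop := fun σ z => z ∈ flat E σ ∧ l z = 0 ∧ z ≠ 0
  let z : {σ : ι → CSign // ∃ z, P σ z} → V := fun σ => σ.2.choose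
  have hz : ∀ σ, P σ.1 (z σ) := fun σ => σ.2.choose_spec
  obtain ⟨g, hg⟩ := Module.exists_dual_forall_apply_ne_zero (K := ℝ) z fun σ => (hz σ).2.2
  have hne : ∀ x, u x ≠ 0 → ∀ᶠ ε : ℝ in 𝓝[>] 0, (u + ε • g) x ≠ 0 := fun x hx => by
    filter_upwards [eventually_sign (u x) (g x)] with ε h
    simp only [LinearMap.add_apply, LinearMap.smul_apply, smul_eq_mul]
    rcases lt_or_gt_of_ne hx with h' | h'
    · exact (h.2.1 h').ne
    · exact (h.1 h').ne'
  have e1 : ∀ᶠ ε : ℝ in 𝓝[>] 0, ∀ σ, (u + ε • g) (z σ) ≠ 0 := by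
    refine eventually_all.2 fun σ => ?_
    by_cases h : u (z σ) = 0
    · filter_upwards [self_mem_nhdsWithin] with ε hε
      rw [LinearMap.add_apply, h, zero_add, LinearMap.smul_apply]
      exact smul_ne_zero (ne_of_gt hε) (hg σ)
    · exact hne _ h
  have e2 : ∀ᶠ ε : ℝ in 𝓝[>] 0, ∀ σ : ι → CSign, ∀ x, x ≠ 0 → signVec E x = σ →
      ∃ y ∈ flat E σ, (u + ε • g) y ≠ 0 := by
    refine eventually_all.2 fun σ => ?_
    by_cases h : ∃ x, x ≠ 0 ∧ signVec E x = σ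
    · obtain ⟨x, hx, rfl⟩ := h
      obtain ⟨y, hy, huy⟩ := hu x hx
      filter_upwards [hne y huy] with ε hε _ _ _ using ⟨y, hy, hε⟩
    · exact Eventually.of_forall fun _ x hx hσ => absurd ⟨x, hx, hσ⟩ h
  -- Both sides are stable: positivity holds uniformly on a compact set of unit vectors, and by
  -- general position its failure is witnessed by a strictly negative value.
  have e3 : ∀ᶠ ε : ℝ in 𝓝[>] 0, ∀ σ : ι → CSign, (∃ x, signVec E x = σ) →
      ((∀ y, y ≠ 0 → signVec E y ≤ σ → 0 < (u + ε • g) y) ↔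
        ∀ y, y ≠ 0 → signVec E y ≤ σ → 0 < u y) := by
    refine eventually_all.2 fun σ => ?_
    by_cases hσ : ∃ x, signVec E x = σ
    swap
    · exact Eventually.of_forall fun _ h => absurd h hσ
    obtain ⟨x, rfl⟩ := hσ
    by_cases hpos : ∀ y, y ≠ 0 → signVec E y ≤ signVec E x → 0 < u y
    · have hK : IsCompact {y : V | ‖y‖ = 1 ∧ signVec E y ∈ {τ | τ ≤ signVec E x ∧
          ∃ y, signVec E y = τ}} :=
        isCompact_sphere_inter (Set.toFinite _) (fun σ hσ => hσ.2)
          fun σ hσ y hy => ⟨hy.trans hσ.1, y, rfl⟩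
      have cu : Continuous u := LinearMap.continuous_of_finiteDimensional u
      have cg : Continuous g := LinearMap.continuous_of_finiteDimensional g
      have key : ∀ᶠ ε : ℝ in 𝓝 0, ∀ y ∈ {y : V | ‖y‖ = 1 ∧ signVec E y ∈ {τ | τ ≤ signVec E x ∧
          ∃ y, signVec E y = τ}}, 0 < u y + ε * g y := by
        refine hK.eventually_forall_of_forall_eventually fun y hy => ?_
        have hc : Continuous fun p : ℝ × V => u p.2 + p.1 * g p.2 := by fun_prop
        refine (hc.tendsto (0, y)).eventually_const_lt ?_
        have : y ≠ 0 := fun h => by simpa [h] using hy.1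
        simpa using hpos y this hy.2.1
      filter_upwards [key.filter_mono nhdsWithin_le_nhds] with ε hε _
      refine ⟨fun _ => hpos, fun _ y hy0 hy => ?_⟩
      have hn := inv_pos.2 (norm_pos_iff.2 hy0)
      have h1 := hε ((‖y‖⁻¹ : ℝ) • y) ⟨by
        rw [norm_smul, norm_inv, norm_norm, inv_mul_cancel₀ (norm_ne_zero_iff.2 hy0)],
        by rwa [signVec_smul _ hn], _, rfl⟩
      rw [map_smul, map_smul, smul_eq_mul, smul_eq_mul] at h1
      have h2 : 0 < ‖y‖⁻¹ * (u y + ε * g y) := by linarith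
      simpa using pos_of_mul_pos_right h2 hn.le
    · have hneg : ∃ y, y ≠ 0 ∧ signVec E y ≤ signVec E x ∧ u y < 0 := by
        push Not at hpos
        obtain ⟨y, hy0, hy, huy⟩ := hpos
        rcases huy.lt_or_eq with h | h
        · exact ⟨y, hy0, hy, h⟩
        obtain ⟨w, hw, huw⟩ := hu y hy0
        have key : ∀ w ∈ flat E (signVec E y), u w < 0 →
            ∃ y, y ≠ 0 ∧ signVec E y ≤ signVec E x ∧ u y < 0 := by
          intro w hw huw
          obtain ⟨ε, hε, hs⟩ := exists_signVec_eq hw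
          have h1 : u (y + ε • w) < 0 := by
            rw [map_add, h, zero_add, map_smul]
            exact mul_neg_of_pos_of_neg hε huw
          exact ⟨y + ε • w, fun h0 => by simp [h0] at h1, hs ▸ hy, h1⟩
        rcases lt_or_gt_of_ne huw with h5 | h5
        · exact key w hw h5
        · exact key (-w) (neg_mem hw) (by rw [map_neg]; linarith)
      obtain ⟨y, hy0, hy, huy⟩ := hneg
      filter_upwards [eventually_sign (u y) (g y)] with ε h _
      refine iff_of_false (fun h' => ?_) hpos
      have h1 := h' y hy0 hy
      simp only [LinearMap.add_apply, LinearMap.smul_apply, smul_eq_mul] at h1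
      exact (h.2.1 huy).not_gt h1
  obtain ⟨ε, h1, h2, h3⟩ := (e1.and (e2.and e3)).exists
  refine ⟨u + ε • g, fun x hx => h2 _ x hx rfl, fun x hr hl => ?_, fun W => ?_⟩
  · have hex : ∃ z, P (signVec E x) z := by
      -- A flat of dimension at least two not contained in `ker l` still meets it nontrivially.
      have h4 := finrank_comap_ker (self_mem_flat (E := E) x) hl
      rw [← rank] at h4
      have h5 : 0 < Module.finrank ℝ
        ((flat E (signVec E x)).comap (LinearMap.ker l).subtype) := by omega
      have := Module.finrank_pos_iff.1 h5
      obtain ⟨w, hw⟩ := exists_ne (0 : (flat E (signVec E x)).comap (LinearMap.ker l).subtype)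
      exact ⟨(w : LinearMap.ker l), w.2, (w : LinearMap.ker l).2, fun h => hw (by
        exact Subtype.ext (Subtype.ext h))⟩
    exact ⟨z ⟨_, hex⟩, (hz ⟨_, hex⟩).1, (hz ⟨_, hex⟩).2.1, h1 ⟨_, hex⟩⟩
  · ext σ
    refine and_congr_right fun hσ => h3 σ (hσ.imp fun x hx => hx.2)

end Sweep

/-! ### Induction on dimension and the parity count -/

section Induction

universe u₁ u₂

variable {ι : Type u₁} {V : Type u₂} [NormedAddCommGroup V] [NormedSpace ℝ V]
  [FiniteDimensional ℝ V]
variable {E : ι → (V →ₗ[ℝ] ℝ) × (V →ₗ[ℝ] ℝ)} {u l : V →ₗ[ℝ] ℝ} {v : V}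

/-- The common kernel of the `i`-th pair of functionals. -/
def center {V : Type*} [AddCommGroup V] [Module ℝ V] (E : ι → (V →ₗ[ℝ] ℝ) × (V →ₗ[ℝ] ℝ))
    (i : ι) : Submodule ℝ V := LinearMap.ker (E i).1 ⊓ LinearMap.ker (E i).2

/-- The matching pairs `(σ, τ)` of consecutive dimension such that `τ` lies in the union of the
centers indexed by `A` if `σ` does, unless the dimension of `σ` satisfies `out`. -/
def Matchable {V : Type*} [AddCommGroup V] [Module ℝ V] (E : ι → (V →ₗ[ℝ] ℝ) × (V →ₗ[ℝ] ℝ))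
    (A : Set ι) (out : ℕ → Prop) (σ τ : ι → CSign) : Prop :=
  rank E τ = rank E σ + 1 ∧
    ((∃ i ∈ A, σ i = CSign.zero) → (∃ i ∈ A, τ i = CSign.zero) ∨ out (rank E σ))

omit [FiniteDimensional ℝ V] in
theorem mem_center {i : ι} {x : V} : x ∈ center E i ↔ (E i).1 x = 0 ∧ (E i).2 x = 0 := by
  simp [center]

omit [FiniteDimensional ℝ V] in
theorem signVec_eq_zero_iff {i : ι} {x : V} : signVec E x i = CSign.zero ↔ x ∈ center E i := by
  rw [mem_center, signVec, CSign.ofReal_eq_zero_iff]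

omit [FiniteDimensional ℝ V] in
theorem mem_center_link {i : ι} (hi : signVec E v i = CSign.zero) {w : LinearMap.ker u} :
    w ∈ center (link E v u) i ↔ (w : V) ∈ center E i := by
  rw [signVec_eq_zero_iff, mem_center] at hi
  simp [mem_center, link, restrictData, localize, hi]

omit [FiniteDimensional ℝ V] in
theorem iInf_center_link {B : Set ι} (hB : ∀ i ∈ B, signVec E v i = CSign.zero) :
    ⨅ i ∈ B, center (link E v u) i = (⨅ i ∈ B, center E i).comap (LinearMap.ker u).subtype := by
  ext w
  simp only [Submodule.mem_iInf, Submodule.mem_comap, Submodule.subtype_apply]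
  exact forall₂_congr fun i hi => mem_center_link (hB i hi)

omit [FiniteDimensional ℝ V] in
theorem iInf_center_restrictData (B : Set ι) (W : Submodule ℝ V) :
    ⨅ i ∈ B, center (restrictData E W) i = (⨅ i ∈ B, center E i).comap W.subtype := by
  ext w
  simp only [Submodule.mem_iInf, Submodule.mem_comap, Submodule.subtype_apply]
  exact forall₂_congr fun i hi => by simp [mem_center, restrictData]

theorem finrank_ker_add_one (huv : u v ≠ 0) :
    Module.finrank ℝ (LinearMap.ker u) + 1 = Module.finrank ℝ V := by
  have := finrank_comap_ker (u := u) (L := ⊤) (v := v) trivial huv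
  rwa [Submodule.comap_top, finrank_top, finrank_top] at this

omit [FiniteDimensional ℝ V] in
theorem finrank_comap_subtype (W L : Submodule ℝ V) :
    Module.finrank ℝ (L.comap W.subtype) = Module.finrank ℝ (W ⊓ L : Submodule ℝ V) := by
  rw [← Submodule.finrank_map_subtype_eq, Submodule.map_comap_subtype]

omit [FiniteDimensional ℝ V] in
theorem rank_signVec_zero (hE : Pointed E) : rank E (signVec E 0) = 0 := by
  have : flat E (signVec E 0) = ⊥ := by
    refine (Submodule.eq_bot_iff _).2 fun y hy => hE y ?_
    rw [signVec_zero]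
    funext i
    have := mem_flat_signVec.1 hy i
    simp only [map_zero, forall_const] at this
    rw [signVec, CSign.ofReal_eq_zero_iff]
    exact this
  rw [rank, this, finrank_bot]

omit [FiniteDimensional ℝ V] in
theorem rank_restrictData {W : Submodule ℝ V} {σ : ι → CSign} (h : flat E σ ≤ W) :
    rank (restrictData E W) σ = rank E σ := by
  rw [rank, flat_restrictData, finrank_comap_subtype, inf_eq_right.2 h, rank]

omit [FiniteDimensional ℝ V] in
theorem cells_restrictData {W : Submodule ℝ V} (hW : ∀ x ∈ W, flat E (signVec E x) ≤ W) :
    cells (restrictData E W) (u.domRestrict W) ⊤ = cells E u W := by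
  ext σ
  constructor
  · rintro ⟨⟨x, -, rfl⟩, h⟩
    refine ⟨⟨x, x.2, rfl⟩, fun y hy0 hy => ?_⟩
    exact h ⟨y, hW _ x.2 (mem_flat_of_le hy)⟩ (fun h0 => hy0 (congrArg Subtype.val h0)) hy
  · rintro ⟨⟨x, hx, rfl⟩, h⟩
    exact ⟨⟨⟨x, hx⟩, trivial, rfl⟩, fun y hy0 hy => h y (fun h0 => hy0 (Subtype.ext h0)) hy⟩

omit [FiniteDimensional ℝ V] in
/-- A complete removal on a subspace is one in the ambient space. -/
theorem coll_of_restrictData {W : Submodule ℝ V} (hW : ∀ x ∈ W, flat E (signVec E x) ≤ W)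
    {A : Set ι} {out : ℕ → Prop}
    (h : Coll (Matchable (restrictData E W) A out)
      (cells (restrictData E W) (u.domRestrict W) ⊤) ∅) :
    Coll (Matchable E A out) (cells E u W) ∅ := by
  rw [cells_restrictData hW] at h
  refine h.mono ?_
  rintro _ ⟨⟨x, hx, rfl⟩, -⟩ _ ⟨⟨y, hy, rfl⟩, -⟩ hxy
  rwa [Matchable, rank_restrictData (hW x hx), rank_restrictData (hW y hy)] at hxy

/-- Genericity supplies w in the span with l w = 0 and u w ≠ 0. Subtracting a multiple of w from v
reaches `ker u` without changing the value l v ≠ 0. -/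
theorem link_genPos [Finite ι] (hl : Compatible E l) (hgen : GenericPair E u l) (huv : 0 < u v)
    (hlv : l v ≠ 0) : GenPos (link E v u) (-((l v • l).domRestrict (LinearMap.ker u))) := by
  intro z hz
  obtain ⟨ε, hε, -, h⟩ := exists_add_smul_eq_comp (E := E) v (z : V) (b := 0) one_pos
  have h1 := rank_comp (E := E) huv.ne' z
  have h2 := rank_pos (E := link E v u) hz
  have hvx : signVec E v ≤ signVec E (v + ε • (z : V)) := by
    rw [h]
    exact fun i => CSign.le_comp _ _
  obtain ⟨w, hw, hlw, huw⟩ := hgen (v + ε • (z : V)) (by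
    rw [h]
    rw [signVec_link] at h1 h2
    omega) fun h0 => hlv ((hl _ v hvx).2 h0)
  rw [h, flat_comp] at hw
  have hker : v - (u v / u w) • w ∈ LinearMap.ker u := by
    rw [LinearMap.mem_ker, map_sub, map_smul, smul_eq_mul, div_mul_cancel₀ _ huw, sub_self]
  have hflat : v - (u v / u w) • w ∈ flat (localize E v) (signVec (localize E v) z) :=
    sub_mem (mem_flat_localize _) (Submodule.smul_mem _ _ hw)
  refine ⟨⟨_, hker⟩, hflat, ?_⟩
  rw [LinearMap.neg_apply, LinearMap.domRestrict_apply, LinearMap.smul_apply, map_sub, map_smul,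
    hlw, smul_zero, sub_zero, smul_eq_mul]
  exact neg_ne_zero.2 (mul_ne_zero hlv hlv)

omit [FiniteDimensional ℝ V] in
theorem restrictData_pointed (hE : Pointed E) (W : Submodule ℝ V) :
    Pointed (restrictData E W) := fun x hx => Subtype.ext (hE x hx)

omit [FiniteDimensional ℝ V] in
theorem restrictData_genPos (hu : GenPos E u) {W : Submodule ℝ V}
    (hW : ∀ x ∈ W, flat E (signVec E x) ≤ W) :
    GenPos (restrictData E W) (u.domRestrict W) := by
  intro x hx
  obtain ⟨y, hy, huy⟩ := hu x fun h => hx (Subtype.ext h)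
  exact ⟨⟨y, hW x x.2 hy⟩, hy, huy⟩

/-- The inductive step: sweep to the kernel of `l`, then remove the rest. -/
theorem coll_of_link_of_ker [Finite ι] (hE : Pointed E) (hu : GenPos E u) (hl : Compatible E l)
    {A : Set ι} {out : ℕ → Prop}
    (hlink : ∀ (u' : V →ₗ[ℝ] ℝ) (v : V), 0 < u' v → l v ≠ 0 → Pointed (link E v u') →
      GenPos (link E v u') (-((l v • l).domRestrict (LinearMap.ker u'))) →
      Coll (Matchable (link E v u') {i | i ∈ A ∧ signVec E v i = CSign.zero} fun r => out (r + 1))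
        (cells (link E v u') (-((l v • l).domRestrict (LinearMap.ker u'))) ⊤) ∅)
    (hker : Pointed (restrictData E (LinearMap.ker l)) →
      GenPos (restrictData E (LinearMap.ker l)) (u.domRestrict (LinearMap.ker l)) →
      Coll (Matchable (restrictData E (LinearMap.ker l)) A out)
        (cells (restrictData E (LinearMap.ker l)) (u.domRestrict (LinearMap.ker l)) ⊤) ∅) :
    Coll (Matchable E A out) (cells E u ⊤) ∅ := by
  have hW : ∀ x ∈ LinearMap.ker l, flat E (signVec E x) ≤ LinearMap.ker l :=
    fun x hx => hl.flat_le hx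
  refine Relation.ReflTransGen.trans ?_ (coll_of_restrictData hW
    (hker (restrictData_pointed hE _) (restrictData_genPos hu hW)))
  -- The perturbed functional has the same cells, so it may drive the sweep in place of u.
  obtain ⟨u', hu', hgen, hcells⟩ := exists_genericPair hu l
  rw [← hcells, ← hcells]
  refine sweep hE hl hgen fun v huv hlv hv => ?_
  refine (hlink u' v huv hlv (link_pointed hv huv.ne') (link_genPos hl hgen huv hlv)).mono ?_
  rintro _ ⟨⟨x, -, rfl⟩, -⟩ _ ⟨⟨y, -, rfl⟩, -⟩ ⟨h1, h2⟩
  refine ⟨?_, ?_⟩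
  · rw [rank_comp huv.ne', rank_comp huv.ne', h1]
  -- A cone of the star lies in the i-th center iff v does and the link cone does; hence only
  -- centers through v matter, and `out` is shifted by one rank.
  · rw [rank_comp huv.ne']
    rintro ⟨i, hi, hi'⟩
    rw [CSign.comp_eq_zero_iff] at hi'
    refine (h2 ⟨i, ⟨hi, hi'.1⟩, hi'.2⟩).imp_left ?_
    rintro ⟨j, ⟨hj, hj'⟩, hj''⟩
    exact ⟨j, hj, CSign.comp_eq_zero_iff.2 ⟨hj', hj''⟩⟩

/-- The one-dimensional case. -/
theorem coll_of_finrank_eq_one (hV : Module.finrank ℝ V = 1) (hE : Pointed E) (hu : GenPos E u)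
    {A : Set ι} {out : ℕ → Prop} (hA : A.Nonempty → (∃ i ∈ A, center E i = ⊤) ∨ out 0) :
    Coll (Matchable E A out) (cells E u ⊤) ∅ := by
  obtain ⟨v, huv⟩ : ∃ v, 0 < u v := by
    have : Nontrivial V := Module.finrank_pos_iff (R := ℝ).1 (by omega)
    obtain ⟨x, hx⟩ := exists_ne (0 : V)
    obtain ⟨y, -, hy⟩ := hu x hx
    rcases lt_or_gt_of_ne hy with h | h
    · exact ⟨-y, by rw [map_neg]; linarith⟩
    · exact ⟨y, h⟩
  have hv0 : v ≠ 0 := fun h => huv.ne' (by rw [h, map_zero])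
  have hspan : ∀ x, ∃ c : ℝ, c • v = x := (finrank_eq_one_iff_of_nonzero' v hv0).1 hV
  have hsv : signVec E v ≠ signVec E 0 := fun h => hv0 (hE v h)
  have hvmem : signVec E v ∈ cells E u ⊤ := by
    refine ⟨⟨v, trivial, rfl⟩, fun y hy0 hy => ?_⟩
    obtain ⟨c, rfl⟩ := hspan y
    rcases lt_trichotomy c 0 with hc | rfl | hc
    · exfalso
      -- If the closed ray of v contained a negative multiple of v, then the sum 0 would have the
      -- sign vector of v.
      have h := signVec_smul_add hy one_pos (b := (-c)⁻¹) (inv_nonneg.2 (by linarith))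
      have h0 : (1 : ℝ) • v + (-c)⁻¹ • c • v = 0 := by
        rw [smul_smul, inv_neg, neg_mul, inv_mul_cancel₀ hc.ne, ← add_smul, add_neg_cancel,
          zero_smul]
      rw [h0] at h
      exact hsv h.symm
    · simp at hy0
    · rw [map_smul]
      exact mul_pos hc huv
  have h0mem : signVec E 0 ∈ cells E u ⊤ := by
    refine ⟨⟨0, trivial, rfl⟩, fun y hy0 hy => ?_⟩
    exact absurd (hE y (le_antisymm hy (signVec_zero_le _))) hy0
  have hcells : ∀ σ ∈ cells E u ⊤, σ = signVec E 0 ∨ σ = signVec E v := by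
    rintro _ ⟨⟨x, -, rfl⟩, hx⟩
    obtain ⟨c, rfl⟩ := hspan x
    rcases lt_trichotomy c 0 with hc | rfl | hc
    · have := hx (c • v) (smul_ne_zero hc.ne hv0) le_rfl
      rw [map_smul] at this
      exact absurd this (mul_neg_of_neg_of_pos hc huv).not_gt
    · exact Or.inl (by rw [zero_smul])
    · exact Or.inr (signVec_smul _ hc)
  refine Relation.ReflTransGen.single ⟨_, h0mem, _, hvmem,
    lt_of_le_of_ne (signVec_zero_le _) hsv.symm, ⟨?_, ?_⟩, ?_, ?_⟩
  · rw [rank_signVec_zero hE]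
    refine le_antisymm ?_ (rank_pos hv0)
    rw [zero_add, ← hV]
    exact Submodule.finrank_le _
  · rintro ⟨i, hi, -⟩
    rw [rank_signVec_zero hE]
    refine (hA ⟨i, hi⟩).imp_left ?_
    rintro ⟨j, hj, hj'⟩
    exact ⟨j, hj, signVec_eq_zero_iff.2 (hj' ▸ trivial)⟩
  · exact fun r hr hlt => (hcells r hr).resolve_left hlt.ne'
  · refine (Set.eq_empty_iff_forall_notMem.2 fun r hr => hr.2 ?_).symm
    exact hcells r hr.1

omit [FiniteDimensional ℝ V] in
theorem compatible_fst (i : ι) : Compatible E (E i).1 := fun x y h => by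
  obtain ⟨h1, h2, h3, -⟩ := CSign.ofReal_le_iff.1 (h i)
  refine ⟨?_, h3⟩
  rcases lt_trichotomy ((E i).1 x) 0 with h | h | h
  · exact mul_nonneg_of_nonpos_of_nonpos h.le (h2 h)
  · rw [h, zero_mul]
  · exact mul_nonneg h.le (h1 h)

omit [FiniteDimensional ℝ V] in
theorem compatible_snd {i : ι} (hi : (E i).1 = 0) : Compatible E (E i).2 := fun x y h => by
  obtain ⟨-, -, -, h1, h2, h3⟩ := CSign.ofReal_le_iff.1 (h i)
  have hx : (E i).1 x = 0 := by rw [hi, LinearMap.zero_apply]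
  refine ⟨?_, h3 hx⟩
  rcases lt_trichotomy ((E i).2 x) 0 with h | h | h
  · exact mul_nonneg_of_nonpos_of_nonpos h.le (h2 hx h)
  · rw [h, zero_mul]
  · exact mul_nonneg h.le (h1 hx h)

/-- The cones on which a functional in general position is positive can be removed completely. -/
theorem coll_cells [Finite ι] (n : ℕ) : ∀ {V : Type u₂} [NormedAddCommGroup V] [NormedSpace ℝ V]
    [FiniteDimensional ℝ V] {E : ι → (V →ₗ[ℝ] ℝ) × (V →ₗ[ℝ] ℝ)} {u : V →ₗ[ℝ] ℝ},
    Module.finrank ℝ V = n + 1 → Pointed E → GenPos E u →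
    Coll (Matchable E ∅ fun _ => False) (cells E u ⊤) ∅ := by
  induction n with
  | zero =>
    intro V _ _ _ E u hV hE hu
    exact coll_of_finrank_eq_one hV hE hu (by simp)
  | succ n ih =>
    intro V _ _ _ E u hV hE hu
    -- If every compatible functional vanished, all pairs in `E` would be zero, contrary to
    -- pointedness in positive dimension.
    obtain ⟨l, hl, x, hx⟩ : ∃ l : V →ₗ[ℝ] ℝ, Compatible E l ∧ ∃ x, l x ≠ 0 := by
      by_contra! hcon
      have h1 : ∀ i, (E i).1 = 0 := fun i => LinearMap.ext (hcon _ (compatible_fst i))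
      have h2 : ∀ i, (E i).2 = 0 := fun i => LinearMap.ext (hcon _ (compatible_snd (h1 i)))
      have : Nontrivial V := Module.finrank_pos_iff (R := ℝ).1 (by omega)
      obtain ⟨x, hx⟩ := exists_ne (0 : V)
      refine hx (hE x ?_)
      funext i
      simp [signVec, h1, h2]
    refine coll_of_link_of_ker hE hu hl (fun u' v huv hlv h1 h2 => ?_) fun h1 h2 => ?_
    · refine (ih (by have := finrank_ker_add_one huv.ne'; omega) h1 h2).mono ?_
      rintro σ - τ - ⟨h, -⟩
      exact ⟨h, by simp⟩
    · exact ih (by have := finrank_ker_add_one hx; omega) h1 h2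

/-- When one center is everything, every cone lies in the arrangement and no outward match can
occur, so the unrestricted removal serves. -/
theorem coll_cells_of_center_eq_top [Finite ι] (hV : Module.finrank ℝ V ≠ 0) (hE : Pointed E)
    (hu : GenPos E u) {A : Set ι} {i : ι} (hi : i ∈ A) (hc : center E i = ⊤) (out : ℕ → Prop) :
    Coll (Matchable E A out) (cells E u ⊤) ∅ := by
  obtain ⟨n, hn⟩ := Nat.exists_eq_succ_of_ne_zero hV
  refine (coll_cells n hn hE hu).mono ?_
  rintro σ - _ ⟨⟨y, -, rfl⟩, -⟩ ⟨h, -⟩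
  exact ⟨h, fun _ => Or.inl ⟨i, hi, signVec_eq_zero_iff.2 (hc ▸ trivial)⟩⟩

theorem coll_cells_of_eq_empty [Finite ι] (hV : Module.finrank ℝ V ≠ 0) (hE : Pointed E)
    (hu : GenPos E u) {A : Set ι} (hA : A = ∅) (out : ℕ → Prop) :
    Coll (Matchable E A out) (cells E u ⊤) ∅ := by
  obtain ⟨n, hn⟩ := Nat.exists_eq_succ_of_ne_zero hV
  refine (coll_cells n hn hE hu).mono ?_
  rintro σ - τ - ⟨h, -⟩
  exact ⟨h, by simp [hA]⟩

omit [FiniteDimensional ℝ V] in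
/-- If the centers through `v` meet only in the origin after passing to the link, then all centers
meet only in the origin, provided that they lie in a subspace not containing `v`. -/
theorem iInf_center_eq_bot_of_link {A : Set ι} {W : Submodule ℝ V}
    (hW : ⨅ i ∈ A, center E i ≤ W) (hvW : v ∉ W) (huv : u v ≠ 0)
    (h : ⨅ i ∈ {i | i ∈ A ∧ signVec E v i = CSign.zero}, center (link E v u) i = ⊥) :
    ⨅ i ∈ A, center E i = ⊥ := by
  rw [iInf_center_link fun i hi => hi.2] at h
  refine (Submodule.eq_bot_iff _).2 fun w hw => ?_
  have hmem : w - (u w / u v) • v ∈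
      ⨅ i ∈ {i | i ∈ A ∧ signVec E v i = CSign.zero}, center E i := by
    simp only [Submodule.mem_iInf] at hw ⊢
    exact fun i hi => sub_mem (hw i hi.1)
      (Submodule.smul_mem _ _ (signVec_eq_zero_iff.1 hi.2))
  have hker : w - (u w / u v) • v ∈ LinearMap.ker u := by
    rw [LinearMap.mem_ker, map_sub, map_smul, smul_eq_mul, div_mul_cancel₀ _ huv, sub_self]
  have h1 : (⟨_, hker⟩ : LinearMap.ker u) ∈ (⊥ : Submodule ℝ (LinearMap.ker u)) := h ▸ hmem
  have h2 : w - (u w / u v) • v = 0 := congrArg Subtype.val ((Submodule.mem_bot ℝ).1 h1)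
  by_cases hc : u w / u v = 0
  · rwa [hc, zero_smul, sub_zero] at h2
  · have h3 : (u w / u v) • v ∈ W := sub_eq_zero.1 h2 ▸ hW hw
    exact absurd ((Submodule.smul_mem_iff _ hc).1 h3) hvW

/-- Every intersection of centers is trivial or of even codimension. -/
def EvenCodim {V : Type*} [AddCommGroup V] [Module ℝ V] (E : ι → (V →ₗ[ℝ] ℝ) × (V →ₗ[ℝ] ℝ))
    (A : Set ι) : Prop :=
  ∀ B ⊆ A, B.Nonempty → ⨅ i ∈ B, center E i = ⊥ ∨
    ∃ k, Module.finrank ℝ (⨅ i ∈ B, center E i : Submodule ℝ V) + 2 * k = Module.finrank ℝ V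

/-- The induction step for an arrangement traced on a hyperplane containing one of its elements,
which becomes the kernel of the `i`-th second functional. -/
theorem coll_cells_of_fst_eq_zero [Finite ι] (n : ℕ)
    (ih : ∀ {V : Type u₂} [NormedAddCommGroup V] [NormedSpace ℝ V] [FiniteDimensional ℝ V]
      {E : ι → (V →ₗ[ℝ] ℝ) × (V →ₗ[ℝ] ℝ)} {u : V →ₗ[ℝ] ℝ} {A : Set ι} {out : ℕ → Prop},
      Module.finrank ℝ V = n → n ≠ 0 → Pointed E → GenPos E u → A.Nonempty → EvenCodim E A →
      (⨅ i ∈ A, center E i = ⊥ → out ((n - 1) / 2)) →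
      Coll (Matchable E A out) (cells E u ⊤) ∅)
    (hV : Module.finrank ℝ V = n + 1) (hE : Pointed E) (hu : GenPos E u) {A : Set ι} {i : ι}
    (hi : i ∈ A) (hi1 : (E i).1 = 0) (hi2 : (E i).2 ≠ 0)
    (harr : ∀ B ⊆ A, B.Nonempty → ¬ ⨅ i ∈ B, center E i ≤ center E i →
      (⨅ i ∈ B, center E i) ⊓ center E i = ⊥ ∨
      ∃ k, Module.finrank ℝ (⨅ i ∈ B, center E i : Submodule ℝ V) + 2 * k = Module.finrank ℝ V)
    {out : ℕ → Prop} (hout : ⨅ i ∈ A, center E i = ⊥ → out ((n + 1) / 2)) :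
    Coll (Matchable E A out) (cells E u ⊤) ∅ := by
  have hcenter : center E i = LinearMap.ker (E i).2 := by
    rw [center, hi1, LinearMap.ker_zero, top_inf_eq]
  obtain ⟨x, hx⟩ : ∃ x, (E i).2 x ≠ 0 := by
    by_contra! hcon
    exact hi2 (LinearMap.ext hcon)
  have hdim := finrank_ker_add_one hx
  rcases Nat.eq_zero_or_pos n with rfl | hn
  -- On a line the center is the origin, so the zero cone must be matched outwardly, in rank 0 = (0
  -- + 1) / 2.
  · refine coll_of_finrank_eq_one hV hE hu fun _ => Or.inr (hout ?_)
    refine eq_bot_iff.2 ((iInf₂_le i hi).trans ?_)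
    rw [hcenter, ← Submodule.finrank_eq_zero.1 (show Module.finrank ℝ
      (LinearMap.ker (E i).2) = 0 by omega)]
  refine coll_of_link_of_ker hE hu (compatible_snd hi1) (fun u' v huv hlv h1 h2 => ?_)
    fun h1 h2 => ?_
  · have hdim' := finrank_ker_add_one huv.ne'
    rcases Set.eq_empty_or_nonempty {i | i ∈ A ∧ signVec E v i = CSign.zero} with hAv | hAv
    · exact coll_cells_of_eq_empty (by omega) h1 h2 hAv _
    refine ih (by omega) hn.ne' h1 h2 hAv (fun B hB hBne => ?_) fun hbot => ?_
    · rw [iInf_center_link fun i hi => (hB hi).2]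
      have hvB : v ∈ ⨅ i ∈ B, center E i := by
        simp only [Submodule.mem_iInf]
        exact fun i hi => signVec_eq_zero_iff.1 (hB hi).2
      have hvi : v ∉ center E i := by rwa [hcenter, LinearMap.mem_ker]
      rcases harr B (fun i hi => (hB hi).1) hBne (fun h => hvi (h hvB)) with h | ⟨k, hk⟩
      · left
        refine (Submodule.eq_bot_iff _).2 fun w hw => Subtype.ext ?_
        have huw : u' (w : V) = 0 := w.2
        -- An intersection that is trivial on the hyperplane is at most a line, here the line of v;
        -- this combination of v and w is killed by the second functional, hence is zero.
        have hmem : (E i).2 w • v - (E i).2 v • (w : V) ∈ (⨅ i ∈ B, center E i) ⊓ center E i := by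
          refine ⟨sub_mem (Submodule.smul_mem _ _ hvB) (Submodule.smul_mem _ _ hw), ?_⟩
          rw [SetLike.mem_coe, hcenter, LinearMap.mem_ker, map_sub, map_smul, map_smul, smul_eq_mul,
            smul_eq_mul, mul_comm, sub_self]
        rw [h, Submodule.mem_bot] at hmem
        have h3 := congrArg u' hmem
        rw [map_sub, map_smul, map_smul, huw, smul_zero, sub_zero, map_zero, smul_eq_mul] at h3
        rw [(mul_eq_zero.1 h3).resolve_right huv.ne', zero_smul, zero_sub, neg_eq_zero] at hmem
        exact (smul_eq_zero.1 hmem).resolve_left hlv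
      · right
        refine ⟨k, ?_⟩
        have := finrank_comap_ker hvB huv.ne'
        omega
    -- The link has dimension n, and its outward rank (n - 1) / 2 rises by one on returning to the
    -- star.
    · have h3 := hout (iInf_center_eq_bot_of_link (W := center E i) (iInf₂_le i hi)
        (by rwa [hcenter, LinearMap.mem_ker]) huv.ne' hbot)
      rwa [show (n - 1) / 2 + 1 = (n + 1) / 2 by omega]
  · refine coll_cells_of_center_eq_top (by omega) h1 h2 hi ?_ out
    refine (Submodule.eq_top_iff').2 fun w => mem_center.2 ⟨?_, w.2⟩
    simp [restrictData, hi1]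

/-- Complete removal on the hyperplane `ker (E i).1`, for an arrangement of even codimension. -/
theorem coll_cells_restrictData_ker_fst [Finite ι] (m : ℕ)
    (ih : ∀ {V : Type u₂} [NormedAddCommGroup V] [NormedSpace ℝ V] [FiniteDimensional ℝ V]
      {E : ι → (V →ₗ[ℝ] ℝ) × (V →ₗ[ℝ] ℝ)} {u : V →ₗ[ℝ] ℝ} {A : Set ι} {out : ℕ → Prop},
      Module.finrank ℝ V = m → m ≠ 0 → Pointed E → GenPos E u → A.Nonempty → EvenCodim E A →
      (⨅ i ∈ A, center E i = ⊥ → out ((m - 1) / 2)) →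
      Coll (Matchable E A out) (cells E u ⊤) ∅)
    (hV : Module.finrank ℝ V = m + 2) {A : Set ι} {i : ι} (hi : i ∈ A) {x : V}
    (hx : (E i).1 x ≠ 0) (hm : (restrictData E (LinearMap.ker (E i).1) i).2 ≠ 0)
    (harr : EvenCodim E A) {out : ℕ → Prop}
    (hout : ⨅ i ∈ A, center E i = ⊥ → out ((m + 1) / 2))
    (h1 : Pointed (restrictData E (LinearMap.ker (E i).1)))
    (h2 : GenPos (restrictData E (LinearMap.ker (E i).1)) (u.domRestrict (LinearMap.ker (E i).1))) :
    Coll (Matchable (restrictData E (LinearMap.ker (E i).1)) A out)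
      (cells (restrictData E (LinearMap.ker (E i).1))
        (u.domRestrict (LinearMap.ker (E i).1)) ⊤) ∅ := by
  have hdim := finrank_ker_add_one hx
  refine coll_cells_of_fst_eq_zero m ih (by omega) h1 h2 hi
    (LinearMap.ext fun w => w.2) hm (fun B hB hBne hnle => ?_) fun hbot => ?_
  · rw [iInf_center_restrictData] at hnle ⊢
    obtain ⟨w, hwB, hwi⟩ := SetLike.not_le_iff_exists.1 hnle
    have hmw : (E i).2 w ≠ 0 := fun h => hwi (mem_center.2 ⟨w.2, h⟩)
    -- Adjoin i to B: the evenness hypothesis then controls the part of the intersection inside the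
    -- i-th center.
    have hY : ⨅ j ∈ insert i B, center E j =
        LinearMap.ker (E i).2 ⊓ (LinearMap.ker (E i).1 ⊓ ⨅ j ∈ B, center E j) := by
      rw [iInf_insert, center, ← inf_assoc, inf_comm (LinearMap.ker (E i).2)]
    rcases harr (insert i B) (Set.insert_subset hi hB) (Set.insert_nonempty i B) with h | ⟨k, hk⟩
    · left
      refine (Submodule.eq_bot_iff _).2 fun y hy => Subtype.ext ?_
      have h3 : (y : V) ∈ ⨅ j ∈ insert i B, center E j := by
        rw [hY]
        exact ⟨(mem_center.1 hy.2).2, y.2, hy.1⟩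
      rwa [h] at h3
    · right
      have h3 := finrank_comap_ker (u := (E i).2) (v := (w : V))
        (L := LinearMap.ker (E i).1 ⊓ ⨅ j ∈ B, center E j) ⟨w.2, hwB⟩ hmw
      rw [finrank_comap_subtype, ← hY] at h3
      rw [finrank_comap_subtype]
      have h4 : Module.finrank ℝ
        (LinearMap.ker (E i).1 ⊓ ⨅ j ∈ B, center E j : Submodule ℝ V) ≤
          Module.finrank ℝ (LinearMap.ker (E i).1) := Submodule.finrank_mono inf_le_left
      -- The intersection on the hyperplane is one dimension larger than its part in the center,
      -- while the hyperplane is one smaller than `V`; so the codimension 2k drops by two.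
      exact ⟨k - 1, by omega⟩
  · refine hout ?_
    rw [iInf_center_restrictData] at hbot
    refine (Submodule.eq_bot_iff _).2 fun y hy => ?_
    have hyi : y ∈ center E i := (iInf₂_le i hi : ⨅ i ∈ A, center E i ≤ _) hy
    have h3 : (⟨y, hyi.1⟩ : LinearMap.ker (E i).1) ∈
      (⊥ : Submodule ℝ (LinearMap.ker (E i).1)) := hbot ▸ hy
    exact congrArg Subtype.val ((Submodule.mem_bot ℝ).1 h3)

/-- The cones on which a functional in general position is positive can be removed completely,
respecting an arrangement of even codimension. -/
theorem coll_cells_of_evenCodim [Finite ι] (n : ℕ) :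
    ∀ {V : Type u₂} [NormedAddCommGroup V] [NormedSpace ℝ V] [FiniteDimensional ℝ V]
      {E : ι → (V →ₗ[ℝ] ℝ) × (V →ₗ[ℝ] ℝ)} {u : V →ₗ[ℝ] ℝ} {A : Set ι} {out : ℕ → Prop},
      Module.finrank ℝ V = n → n ≠ 0 → Pointed E → GenPos E u → A.Nonempty → EvenCodim E A →
      (⨅ i ∈ A, center E i = ⊥ → out ((n - 1) / 2)) →
      Coll (Matchable E A out) (cells E u ⊤) ∅ := by
  induction n using Nat.strong_induction_on with
  | _ n ih =>
  intro V _ _ _ E u A out hV hn hE hu hA harr hout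
  obtain ⟨i, hi⟩ := hA
  by_cases htop : center E i = ⊤
  · exact coll_cells_of_center_eq_top (by omega) hE hu hi htop out
  rcases Nat.lt_or_ge n 2 with hn2 | hn2
  · obtain rfl : n = 1 := by omega
    refine coll_of_finrank_eq_one hV hE hu fun _ => Or.inr (hout ?_)
    refine eq_bot_iff.2 ((iInf₂_le i hi).trans (Submodule.finrank_eq_zero.1 ?_).le)
    have := Submodule.finrank_lt htop
    omega
  -- A center of codimension one violates parity, so both functionals are needed: the first is
  -- nonzero, and so is the restriction of the second to its kernel.
  have hcodim : Module.finrank ℝ (center E i) + 1 ≠ n := by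
    intro h
    have h1 := harr {i} (by simpa using hi) (Set.singleton_nonempty i)
    rw [show ⨅ j ∈ ({i} : Set ι), center E j = center E i by simp] at h1
    rcases h1 with h1 | ⟨k, hk⟩
    · rw [h1, finrank_bot] at h
      omega
    · omega
  have hl : ∃ x, (E i).1 x ≠ 0 := by
    by_contra! hcon
    have h1 : (E i).1 = 0 := LinearMap.ext hcon
    have h2 : center E i = LinearMap.ker (E i).2 := by
      rw [center, h1, LinearMap.ker_zero, top_inf_eq]
    by_cases h3 : ∃ x, (E i).2 x ≠ 0
    · obtain ⟨x, hx⟩ := h3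
      have := finrank_ker_add_one hx
      rw [h2] at hcodim
      omega
    · push Not at h3
      exact htop (h2.trans (LinearMap.ker_eq_top.2 (LinearMap.ext h3)))
  obtain ⟨x, hx⟩ := hl
  have hdim := finrank_ker_add_one hx
  have hm : (restrictData E (LinearMap.ker (E i).1) i).2 ≠ 0 := by
    intro h
    have h1 : center E i = LinearMap.ker (E i).1 :=
      inf_eq_left.2 fun y hy => LinearMap.congr_fun h ⟨y, hy⟩
    rw [h1] at hcodim
    omega
  refine coll_of_link_of_ker hE hu (compatible_fst i) (fun u' v huv hlv h1 h2 => ?_)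
    fun h1 h2 => ?_
  · have hdim' := finrank_ker_add_one huv.ne'
    rcases Set.eq_empty_or_nonempty {i | i ∈ A ∧ signVec E v i = CSign.zero} with hAv | hAv
    · exact coll_cells_of_eq_empty (by omega) h1 h2 hAv _
    have heven : ∀ B ⊆ {i | i ∈ A ∧ signVec E v i = CSign.zero}, B.Nonempty → ∃ k,
        Module.finrank ℝ (⨅ i ∈ B, center (link E v u') i : Submodule ℝ (LinearMap.ker u')) +
          2 * k = Module.finrank ℝ (LinearMap.ker u') := by
      intro B hB hBne
      rw [iInf_center_link fun i hi => (hB hi).2]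
      have hvB : v ∈ ⨅ i ∈ B, center E i := by
        simp only [Submodule.mem_iInf]
        exact fun i hi => signVec_eq_zero_iff.1 (hB hi).2
      rcases harr B (fun i hi => (hB hi).1) hBne with h | ⟨k, hk⟩
      · rw [h, Submodule.mem_bot] at hvB
        rw [hvB, map_zero] at huv
        exact absurd huv (lt_irrefl _)
      · refine ⟨k, ?_⟩
        have := finrank_comap_ker hvB huv.ne'
        omega
    refine ih (n - 1) (by omega) (by omega) (by omega) h1 h2 hAv
      (fun B hB hBne => Or.inr (heven B hB hBne)) fun hbot => ?_
    have h3 := hout (iInf_center_eq_bot_of_link (W := LinearMap.ker (E i).1)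
      ((iInf₂_le i hi).trans inf_le_left) hlv huv.ne' hbot)
    -- A trivial intersection of even codimension makes n - 1 even; only then does the shifted
    -- outward rank of the link equal (n - 1) / 2.
    obtain ⟨k, hk⟩ := heven _ subset_rfl hAv
    rw [hbot, finrank_bot] at hk
    rwa [show (n - 1 - 1) / 2 + 1 = (n - 1) / 2 by omega]
  · obtain ⟨m, rfl⟩ : ∃ m, n = m + 2 := ⟨n - 2, by omega⟩
    exact coll_cells_restrictData_ker_fst m (ih m (by omega)) hV hi hx hm harr hout h1 h2

end Induction

/-! ### Strata and faces as fibres of the sign vector -/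

section Geometry

variable {d : ℕ} {ι : Type*}

/-- The closed spherical face with a given sign vector. -/
def cellSet (D : ι → (Ambient d →ₗ[ℝ] ℝ) × (Ambient d →ₗ[ℝ] ℝ)) (σ : ι → CSign) :
    Set (Ambient d) := {y | y ∈ unitSphere d ∧ signVec D y ≤ σ}

variable {D : ι → (Ambient d →ₗ[ℝ] ℝ) × (Ambient d →ₗ[ℝ] ℝ)}

theorem mem_unitSphere {x : Ambient d} : x ∈ unitSphere d ↔ ‖x‖ = 1 := by
  simp [unitSphere]

theorem ne_zero_of_mem_unitSphere {x : Ambient d} (hx : x ∈ unitSphere d) : x ≠ 0 := by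
  rintro rfl
  simp [mem_unitSphere] at hx

theorem normalize_mem_unitSphere {x : Ambient d} (hx : x ≠ 0) :
    (‖x‖⁻¹ : ℝ) • x ∈ unitSphere d := by
  rw [mem_unitSphere, norm_smul, norm_inv, norm_norm, inv_mul_cancel₀ (norm_ne_zero_iff.2 hx)]

theorem signVec_normalize {x : Ambient d} (hx : x ≠ 0) :
    signVec D ((‖x‖⁻¹ : ℝ) • x) = signVec D x :=
  signVec_smul _ (inv_pos.2 (norm_pos_iff.2 hx))

/-- A point y of the closed cone is the limit of the normalized points y + εx, which lie in the open
cone of x. -/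
theorem closure_signVec_fiber (x : Ambient d) :
    closure {y | y ∈ unitSphere d ∧ signVec D y = signVec D x} = cellSet D (signVec D x) := by
  refine Set.Subset.antisymm (closure_minimal (fun y hy => ⟨hy.1, hy.2.le⟩) ?_) ?_
  · exact Metric.isClosed_sphere.inter (isClosed_signVec_le x)
  · rintro y ⟨hy, hyx⟩
    have hc : ContinuousAt (fun ε : ℝ => (‖y + ε • x‖⁻¹ : ℝ) • (y + ε • x)) 0 := by
      have h1 : ContinuousAt (fun ε : ℝ => y + ε • x) 0 := by fun_prop
      refine (h1.norm.inv₀ ?_).smul h1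
      rw [zero_smul, add_zero, mem_unitSphere.1 hy]
      exact one_ne_zero
    have ht : Filter.Tendsto (fun ε : ℝ => (‖y + ε • x‖⁻¹ : ℝ) • (y + ε • x))
        (nhdsWithin 0 (Set.Ioi 0)) (nhds y) := by
      have h2 := hc.tendsto
      simp only [zero_smul, add_zero, mem_unitSphere.1 hy, inv_one, one_smul] at h2
      exact h2.mono_left nhdsWithin_le_nhds
    have hne : ∀ᶠ ε : ℝ in nhdsWithin 0 (Set.Ioi 0), y + ε • x ≠ 0 := by
      have h1 : Filter.Tendsto (fun ε : ℝ => y + ε • x) (nhds 0) (nhds (y + (0 : ℝ) • x)) :=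
        Continuous.tendsto (by fun_prop) 0
      rw [zero_smul, add_zero] at h1
      exact (h1.eventually_ne (ne_zero_of_mem_unitSphere hy)).filter_mono nhdsWithin_le_nhds
    refine mem_closure_of_tendsto ht ?_
    filter_upwards [hne, self_mem_nhdsWithin] with ε h1 h2
    refine ⟨normalize_mem_unitSphere h1, ?_⟩
    rw [signVec_normalize h1]
    have := signVec_smul_add hyx h2 zero_le_one
    rwa [one_smul, add_comm (ε • x) y] at this

/-- The open cone is relatively open in its flat, so each direction of the flat is a multiple of a
difference of two of its points. -/
theorem span_cellSet [Finite ι] (hD : Pointed D) {x : Ambient d} (hx : x ≠ 0) :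
    Submodule.span ℝ (cellSet D (signVec D x)) = flat D (signVec D x) := by
  refine le_antisymm (Submodule.span_le.2 fun y hy => mem_flat_of_le hy.2) fun y hy => ?_
  have key : ∀ z, signVec D z = signVec D x → z ∈ Submodule.span ℝ (cellSet D (signVec D x)) := by
    intro z hz
    have hz0 : z ≠ 0 := by
      rintro rfl
      exact hx (hD x hz.symm)
    have h1 : (‖z‖⁻¹ : ℝ) • z ∈ cellSet D (signVec D x) :=
      ⟨normalize_mem_unitSphere hz0, by rw [signVec_normalize hz0, hz]⟩
    exact (Submodule.smul_mem_iff _ (inv_ne_zero (norm_ne_zero_iff.2 hz0))).1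
      (Submodule.subset_span h1)
  obtain ⟨ε, hε, hs⟩ := exists_signVec_eq hy
  have h1 := sub_mem (key _ hs) (key x rfl)
  rw [add_sub_cancel_left] at h1
  exact (Submodule.smul_mem_iff _ hε.ne').1 h1

theorem cellSet_subset_iff {x : Ambient d} (hx : x ≠ 0) {τ : ι → CSign} :
    cellSet D (signVec D x) ⊆ cellSet D τ ↔ signVec D x ≤ τ := by
  refine ⟨fun h => ?_, fun h y hy => ⟨hy.1, hy.2.trans h⟩⟩
  have := h ⟨normalize_mem_unitSphere hx, (signVec_normalize hx).le⟩
  rw [← signVec_normalize (D := D) hx]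
  exact this.2

theorem faceDim_cellSet [Finite ι] (hD : Pointed D) {x : Ambient d} (hx : x ≠ 0) :
    faceDim (cellSet D (signVec D x)) = (rank D (signVec D x) : ℤ) - 1 := by
  rw [faceDim, span_cellSet hD hx, rank]

/-- A linear functional that vanishes nowhere or everywhere on a set has the same sign at any two
points joined in this set. -/
theorem sign_eq_of_joinedIn {F : Set (Ambient d)} {x y : Ambient d} (h : JoinedIn F x y)
    (f : Ambient d →ₗ[ℝ] ℝ) (hf : (∀ z ∈ F, f z ≠ 0) ∨ ∀ z ∈ F, f z = 0) :
    (0 < f x ↔ 0 < f y) ∧ (f x < 0 ↔ f y < 0) := by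
  rcases hf with hf | hf
  · obtain ⟨γ, hγ⟩ := h
    have hc : Continuous fun t => f (γ t) :=
      (LinearMap.continuous_of_finiteDimensional f).comp γ.continuous
    have key : ¬ ((∃ a, f (γ a) ≤ 0) ∧ ∃ b, 0 ≤ f (γ b)) := by
      rintro ⟨h1, h2⟩
      obtain ⟨t, ht⟩ := mem_range_of_exists_le_of_exists_ge hc h1 h2
      exact hf _ (hγ t) ht
    have h0 : f (γ 0) = f x := by rw [γ.source]
    have h1 : f (γ 1) = f y := by rw [γ.target]
    have hx := hf _ (hγ 0)
    have hy := hf _ (hγ 1)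
    rw [h0] at hx
    rw [h1] at hy
    have k1 : ¬ (f x < 0 ∧ 0 < f y) := fun ⟨a, b⟩ =>
      key ⟨⟨0, h0 ▸ a.le⟩, 1, h1 ▸ b.le⟩
    have k2 : ¬ (f y < 0 ∧ 0 < f x) := fun ⟨a, b⟩ =>
      key ⟨⟨1, h1 ▸ a.le⟩, 0, h0 ▸ b.le⟩
    rcases lt_or_gt_of_ne hx with a | a <;> rcases lt_or_gt_of_ne hy with b | b
    · exact ⟨iff_of_false a.not_gt b.not_gt, iff_of_true a b⟩
    · exact absurd ⟨a, b⟩ k1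
    · exact absurd ⟨b, a⟩ k2
    · exact ⟨iff_of_true a b, iff_of_false a.not_gt b.not_gt⟩
  · rw [hf x h.source_mem, hf y h.target_mem]
    simp

variable {A : Set (Submodule ℝ (Ambient d))} {E : HyperplaneExtension A}

/-- Pairs of functionals defining the hyperplanes of the extension, and the elements of the
arrangement in their sign hyperplanes. -/
structure Represents (E : HyperplaneExtension A)
    (D : A ⊕ E.extra → (Ambient d →ₗ[ℝ] ℝ) × (Ambient d →ₗ[ℝ] ℝ)) : Prop where
  ker_inl : ∀ h, LinearMap.ker (D (Sum.inl h)).1 = E.sign h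
  center_inl : ∀ h : A, center D (Sum.inl h) = h
  ker_inr : ∀ K : E.extra, LinearMap.ker (D (Sum.inr K)).1 = K
  snd_inr : ∀ K, (D (Sum.inr K)).2 = 0

theorem exists_inf_ker_eq {P W : Submodule ℝ (Ambient d)} (hPW : P ≤ W)
    (h : Module.finrank ℝ P + 1 = Module.finrank ℝ W) :
    ∃ f : Ambient d →ₗ[ℝ] ℝ, W ⊓ LinearMap.ker f = P := by
  obtain ⟨w, hw, hwP⟩ : ∃ w ∈ W, w ∉ P := by
    by_contra! hcon
    have := Submodule.finrank_mono hcon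
    omega
  obtain ⟨f, hfw, hf⟩ := Submodule.exists_le_ker_of_notMem hwP
  refine ⟨f, (Submodule.eq_of_le_of_finrank_eq (le_inf hPW hf) ?_).symm⟩
  have h1 := finrank_comap_ker hw hfw
  rw [finrank_comap_subtype, inf_comm] at h1
  omega

theorem exists_represents (hA : IsTwoArrangement A) (E : HyperplaneExtension A) :
    ∃ D, Represents E D := by
  have hfin : Module.finrank ℝ (Ambient d) = d + 1 := by simp [Ambient]
  have hhyp : ∀ K : Submodule ℝ (Ambient d), IsHyperplane K →
      ∃ f : Ambient d →ₗ[ℝ] ℝ, LinearMap.ker f = K := by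
    intro K hK
    obtain ⟨f, hf⟩ := exists_inf_ker_eq (P := K) (W := ⊤) le_top (by
      rw [finrank_top, hfin]
      rw [IsHyperplane, subsphereDim] at hK
      omega)
    exact ⟨f, by rwa [top_inf_eq] at hf⟩
  choose f hf using fun h : A => hhyp _ (E.sign_isHyperplane h)
  choose g hg using fun h : A => exists_inf_ker_eq (E.le_sign h) (by
    have h1 := E.sign_isHyperplane h
    have h2 := hA.dim_eq h h.2
    rw [IsHyperplane, subsphereDim] at h1
    rw [subsphereDim] at h2
    omega)
  choose k hk using fun K : E.extra => hhyp _ (E.extra_isHyperplane K K.2)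
  refine ⟨Sum.elim (fun h => (f h, g h)) fun K => (k K, 0), ⟨hf, fun h => ?_, hk, fun _ => rfl⟩⟩
  simp only [center, Sum.elim_inl]
  rw [hf, hg]

namespace Represents

variable {D : A ⊕ E.extra → (Ambient d →ₗ[ℝ] ℝ) × (Ambient d →ₗ[ℝ] ℝ)}

theorem mem_element_of_mem_flat (hD : Represents E D) {K : Submodule ℝ (Ambient d)}
    (hK : K ∈ E.elements) {x y : Ambient d} (hx : x ∈ K) (hy : y ∈ flat D (signVec D x)) :
    y ∈ K := by
  rw [mem_flat_signVec] at hy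
  rcases hK with ⟨h, rfl | rfl | rfl⟩ | hK
  · trivial
  · rw [← hD.ker_inl] at hx ⊢
    exact (hy _).1 hx
  · rw [← hD.center_inl, mem_center] at hx ⊢
    exact ⟨(hy _).1 hx.1, (hy _).2 hx.1 hx.2⟩
  · have h1 := hD.ker_inr ⟨K, hK⟩
    simp only at h1
    rw [← h1] at hx ⊢
    exact (hy _).1 hx

theorem mem_element_iff (hD : Represents E D) {K : Submodule ℝ (Ambient d)}
    (hK : K ∈ E.elements) {x y : Ambient d} (h : signVec D x = signVec D y) : x ∈ K ↔ y ∈ K :=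
  ⟨fun hx => hD.mem_element_of_mem_flat hK hx (h ▸ self_mem_flat y),
    fun hy => hD.mem_element_of_mem_flat hK hy (h ▸ self_mem_flat x)⟩

/-- Each subspace of the extension contains the connecting curve or misses it, so by the
intermediate value theorem the defining functionals keep their signs. -/
theorem signVec_eq_of_mem_stratum (hD : Represents E D) {S : Set (Submodule ℝ (Ambient d))}
    {x y : Ambient d} (hy : y ∈ E.stratum S x) : signVec D x = signVec D y := by
  have hdich : ∀ K ∈ E.elements, (∀ z ∈ {z | z ∈ unitSphere d ∧ (∀ K ∈ S, z ∈ K) ∧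
      ∀ K ∈ E.elements \ S, z ∉ K}, z ∉ K) ∨ ∀ z ∈ {z | z ∈ unitSphere d ∧ (∀ K ∈ S, z ∈ K) ∧
      ∀ K ∈ E.elements \ S, z ∉ K}, z ∈ K := by
    intro K hK
    by_cases hKS : K ∈ S
    · exact Or.inr fun z hz => hz.2.1 K hKS
    · exact Or.inl fun z hz => hz.2.2 K ⟨hK, hKS⟩
  have hjoin : JoinedIn _ x y := hy
  have hfst : ∀ i, (0 < (D i).1 x ↔ 0 < (D i).1 y) ∧ ((D i).1 x < 0 ↔ (D i).1 y < 0) := by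
    intro i
    refine sign_eq_of_joinedIn hjoin _ ?_
    rcases i with h | K
    · have := hdich (E.sign h) (Or.inl ⟨h, Or.inr (Or.inl rfl)⟩)
      simpa only [← hD.ker_inl, LinearMap.mem_ker] using this
    · have := hdich K (Or.inr K.2)
      simpa only [← hD.ker_inr, LinearMap.mem_ker] using this
  funext i
  refine CSign.ofReal_eq_iff.2 ⟨(hfst i).1.symm, (hfst i).2.symm, fun h0 => ?_⟩
  rcases i with h | K
  · have hker := hdich (E.sign h) (Or.inl ⟨h, Or.inr (Or.inl rfl)⟩)
    have hcen := hdich h (Or.inl ⟨h, Or.inr (Or.inr rfl)⟩)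
    rw [← hD.ker_inl] at hker
    -- The second functional matters only when the whole curve stays in the sign hyperplane; there
    -- its zeros are exactly the points of h.
    have hker' := hker.resolve_left fun hk => hk y hjoin.target_mem h0
    simp only [← hD.center_inl] at hcen
    have := sign_eq_of_joinedIn hjoin (D (Sum.inl h)).2 (hcen.imp
      (fun hc z hz hz0 => hc z hz (mem_center.2 ⟨hker' z hz, hz0⟩))
      (fun hc z hz => (mem_center.1 (hc z hz)).2))
    exact ⟨this.1.symm, this.2.symm⟩
  · simp [hD.snd_inr]

/-- Fibres of the sign vector are convex cones. A segment in a fibre other than that of 0 misses the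
origin and projects radially to a curve in the stratum. -/
theorem stratum_eq (hD : Represents E D) {S : Set (Submodule ℝ (Ambient d))} {x : Ambient d}
    (hx : x ∈ unitSphere d) (hS : ∀ K ∈ S, x ∈ K) (hS' : ∀ K ∈ E.elements \ S, x ∉ K)
    (hSE : S ⊆ E.elements) (hx0 : signVec D x ≠ signVec D 0) :
    E.stratum S x = {y | y ∈ unitSphere d ∧ signVec D y = signVec D x} := by
  ext y
  constructor
  · intro hy
    exact ⟨(JoinedIn.target_mem hy).1, (hD.signVec_eq_of_mem_stratum hy).symm⟩
  · rintro ⟨hy, hyx⟩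
    have hseg : segment ℝ x y ⊆ {z | signVec D z = signVec D x} := by
      rintro _ ⟨a, b, ha, hb, hab, rfl⟩
      rcases ha.lt_or_eq with ha | rfl
      · exact signVec_smul_add hyx.le ha hb
      · rw [zero_add] at hab
        simpa [hab] using hyx
    have hne : ∀ z ∈ {z | signVec D z = signVec D x}, z ≠ 0 := by
      rintro z hz rfl
      exact hx0 hz.symm
    have hc : ContinuousOn (fun z : Ambient d => (‖z‖⁻¹ : ℝ) • z)
        {z | signVec D z = signVec D x} :=
      (continuousOn_id.norm.inv₀ fun z hz => norm_ne_zero_iff.2 (hne z hz)).smul continuousOn_id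
    have h1 := (JoinedIn.of_segment_subset hseg).map_continuousOn hc
    simp only [mem_unitSphere.1 hx, mem_unitSphere.1 hy, inv_one, one_smul] at h1
    refine h1.mono ?_
    rintro _ ⟨z, hz, rfl⟩
    have hz' : signVec D ((‖z‖⁻¹ : ℝ) • z) = signVec D x :=
      (signVec_normalize (hne z hz)).trans hz
    exact ⟨normalize_mem_unitSphere (hne z hz),
      fun K hK => (hD.mem_element_iff (hSE hK) hz').2 (hS K hK),
      fun K hK h => hS' K hK ((hD.mem_element_iff hK.1 hz').1 h)⟩

theorem faces_eq (hD : Represents E D) (hp : Pointed D) :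
    E.faces = {s | ∃ x, x ≠ 0 ∧ s = cellSet D (signVec D x)} := by
  ext s
  constructor
  · rintro ⟨c, ⟨⟨y, hy⟩, S, hSE, x, rfl⟩, rfl⟩
    obtain ⟨hx, hS, hS'⟩ := JoinedIn.source_mem hy
    have hx0 := ne_zero_of_mem_unitSphere hx
    refine ⟨x, hx0, ?_⟩
    rw [hD.stratum_eq hx hS hS' hSE fun h => hx0 (hp x h), closure_signVec_fiber]
  · rintro ⟨x, hx, rfl⟩
    have hx1 := normalize_mem_unitSphere hx
    have hx0 := ne_zero_of_mem_unitSphere hx1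
    have h1 := hD.stratum_eq (S := {K | K ∈ E.elements ∧ (‖x‖⁻¹ : ℝ) • x ∈ K}) hx1
      (fun K hK => hK.2) (fun K hK h => hK.2 ⟨hK.1, h⟩) (fun K hK => hK.1)
      fun h => hx0 (hp _ h)
    refine ⟨_, ⟨⟨(‖x‖⁻¹ : ℝ) • x, ?_⟩, {K | K ∈ E.elements ∧ (‖x‖⁻¹ : ℝ) • x ∈ K},
      fun K hK => hK.1, (‖x‖⁻¹ : ℝ) • x, rfl⟩, ?_⟩
    · rw [h1]
      exact ⟨hx1, rfl⟩
    · rw [h1, closure_signVec_fiber, signVec_normalize hx]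

end Represents

/-- An open cell of a regular CW structure on the sphere is compact only if it is a point. -/
theorem subsingleton_of_isCompact_openCell {d n : ℕ}
    {f : (Fin n → ℝ) → Ambient d} (hf : ContinuousOn f (Metric.closedBall 0 1))
    (hinj : Set.InjOn f (Metric.closedBall 0 1)) (hK : IsCompact (f '' Metric.ball 0 1)) :
    (f '' Metric.ball 0 1).Subsingleton := by
  rcases Nat.eq_zero_or_pos n with rfl | hn
  · exact Set.subsingleton_of_subsingleton.image f
  exfalso
  have hsub : Metric.ball (0 : Fin n → ℝ) 1 ⊆ Metric.closedBall 0 1 := Metric.ball_subset_closedBall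
  -- Injectivity up to the boundary makes the open ball a closed set, hence equal to the closed
  -- ball. In the sup norm, the constant vector 1 refutes this for n > 0.
  have h1 : Metric.closedBall 0 1 ∩ f ⁻¹' (f '' Metric.ball 0 1) = Metric.ball 0 1 := by
    ext x
    constructor
    · rintro ⟨hx, y, hy, hxy⟩
      rwa [← hinj (hsub hy) hx hxy]
    · exact fun hx => ⟨hsub hx, x, hx, rfl⟩
  have h2 : IsClosed (Metric.ball (0 : Fin n → ℝ) 1) := by
    rw [← h1]
    exact hf.preimage_isClosed_of_isClosed Metric.isClosed_closedBall hK.isClosed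
  have h3 : Metric.closedBall (0 : Fin n → ℝ) 1 ⊆ Metric.ball 0 1 := by
    rw [← closure_ball (0 : Fin n → ℝ) one_ne_zero]
    exact h2.closure_subset
  have h4 : (fun _ => 1 : Fin n → ℝ) ∈ Metric.closedBall (0 : Fin n → ℝ) 1 := by
    simp only [mem_closedBall_zero_iff]
    exact (pi_norm_const_le (1 : ℝ)).trans (by simp)
  have h5 := h3 h4
  have : Nonempty (Fin n) := ⟨⟨0, hn⟩⟩
  rw [mem_ball_zero_iff, pi_norm_const] at h5
  simp at h5

/-- The subspaces of a fine extension have at most a pair of antipodal points in common. -/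
theorem finrank_flat_zero_le_one (hE : E.IsFine)
    {D : A ⊕ E.extra → (Ambient d →ₗ[ℝ] ℝ) × (Ambient d →ₗ[ℝ] ℝ)} (hD : Represents E D) :
    Module.finrank ℝ (flat D (signVec D 0)) ≤ 1 := by
  by_contra! hcon
  set M := flat D (signVec D 0) with hM
  have hMK : ∀ K ∈ E.elements, M ≤ K := fun K hK y hy =>
    hD.mem_element_of_mem_flat hK (zero_mem K) hy
  -- A common subspace of dimension at least two has a connected unit sphere, which is then a single
  -- stratum. This stratum is compact, so fineness would make it a point, yet it contains antipodes.
  have hpc : IsPathConnected (subsphere M) := by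
    have h1 := (isPathConnected_sphere (E := M) (by
      rw [← Module.finrank_eq_rank]
      exact_mod_cast hcon) 0 zero_le_one).image continuous_subtype_val
    have h2 : subsphere M = Subtype.val '' Metric.sphere (0 : M) 1 := by
      ext y
      simp only [subsphere, Set.mem_inter_iff, mem_unitSphere, Set.mem_image,
        mem_sphere_zero_iff_norm, SetLike.mem_coe, Subtype.exists, exists_and_right,
        exists_eq_right, Submodule.coe_norm]
      exact ⟨fun h => ⟨h.2, h.1⟩, fun ⟨a, b⟩ => ⟨b, a⟩⟩
    rw [h2]
    exact h1
  obtain ⟨x, hx⟩ := hpc.nonempty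
  have hstr : E.stratum E.elements x = subsphere M := by
    ext y
    constructor
    · intro hy
      have h1 := hD.signVec_eq_of_mem_stratum hy
      refine ⟨(JoinedIn.target_mem hy).1, ?_⟩
      have h2 : flat D (signVec D y) ≤ M := by
        have h3 := mem_flat_signVec.1 (hx.2 : x ∈ M)
        intro z hz
        rw [← h1, mem_flat_signVec] at hz
        refine mem_flat_signVec.2 fun i => ?_
        have h4 := h3 i
        simp only [map_zero, forall_const] at h4 ⊢
        exact ⟨(hz i).1 h4.1, (hz i).2 h4.1 h4.2⟩
      exact h2 (self_mem_flat y)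
    · intro hy
      refine (hpc.joinedIn x hx y hy).mono fun z hz => ⟨hz.1, fun K hK => hMK K hK hz.2, ?_⟩
      rintro K ⟨h1, h2⟩
      exact absurd h1 h2
  obtain ⟨C, hC, hinj⟩ := hE
  have hmem : subsphere M ∈ E.strata := ⟨hpc.nonempty, _, subset_rfl, x, hstr.symm⟩
  rw [← hC] at hmem
  obtain ⟨n, i, hni⟩ := hmem
  have hcomp : IsCompact (subsphere M) :=
    (isCompact_sphere 0 1).inter_right (Submodule.closed_of_finiteDimensional M)
  have hsub := subsingleton_of_isCompact_openCell (C.continuousOn n i) (hinj n i) (hni ▸ hcomp)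
  rw [← hni] at hsub
  have hx' : -x ∈ subsphere M := ⟨by
    rw [mem_unitSphere, norm_neg]
    exact mem_unitSphere.1 hx.1, neg_mem hx.2⟩
  have h2 : (2 : ℝ) • x = 0 := by
    rw [two_smul]
    exact add_eq_zero_iff_eq_neg.2 (hsub hx hx')
  exact ne_zero_of_mem_unitSphere hx.1 ((smul_eq_zero.1 h2).resolve_left two_ne_zero)

end Geometry

/-! ### Hemispheres, general position and the conclusion -/

section Main

variable {d : ℕ} {A : Set (Submodule ℝ (Ambient d))} {E : HyperplaneExtension A}
  {D : A ⊕ E.extra → (Ambient d →ₗ[ℝ] ℝ) × (Ambient d →ₗ[ℝ] ℝ)} {u : Ambient d}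
  {H : Submodule ℝ (Ambient d)}

theorem subsphere_nonempty_iff {W : Submodule ℝ (Ambient d)} :
    (subsphere W).Nonempty ↔ W ≠ ⊥ := by
  constructor
  · rintro ⟨x, hx, hxW⟩ rfl
    exact ne_zero_of_mem_unitSphere hx ((Submodule.mem_bot ℝ).1 hxW)
  · intro h
    obtain ⟨x, hx, hx0⟩ := Submodule.exists_mem_ne_zero_of_ne_bot h
    exact ⟨_, normalize_mem_unitSphere hx0, Submodule.smul_mem _ _ hx⟩

theorem isEssential_iff : IsEssential A ↔ sInf A = ⊥ := by
  rw [IsEssential, ← Set.not_nonempty_iff_eq_empty, subsphere_nonempty_iff, not_not]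

theorem exists_inner_ne_zero (hu : u ≠ 0) (hF : InGeneralPosition (normalHyperplane u) E.faces)
    {s : Set (Ambient d)} (hs : s ∈ E.faces) {x : Ambient d} (hx : x ∈ s) (hx0 : x ≠ 0) :
    ∃ y ∈ Submodule.span ℝ s, inner ℝ u y ≠ 0 := by
  by_contra! hcon
  have hle : Submodule.span ℝ s ≤ normalHyperplane u := fun y hy =>
    Submodule.mem_orthogonal_singleton_iff_inner_right.2 (hcon y hy)
  -- The zero functional exhibits s as a face of itself. A nonzero span inside the boundary
  -- hyperplane would violate both alternatives of transversality.
  have h1 := hF {s} (by simpa using hs) (Set.singleton_nonempty s) s ⟨0, by simp, by simp⟩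
  rcases h1 with h1 | h1
  · rw [inf_eq_right.2 hle] at h1
    have := Submodule.subset_span (R := ℝ) hx
    rw [h1] at this
    exact hx0 ((Submodule.mem_bot ℝ).1 this)
  · rw [sup_eq_left.2 hle] at h1
    have h2 : u ∈ normalHyperplane u := h1 ▸ trivial
    exact hu (inner_self_eq_zero.1 (Submodule.mem_orthogonal_singleton_iff_inner_right.1 h2))

theorem Represents.genPos (hD : Represents E D) (hp : Pointed D) [Finite A] [Finite E.extra]
    (hu : u ≠ 0) (hF : InGeneralPosition (normalHyperplane u) E.faces) :
    GenPos D (innerₗ (Ambient d) u) := by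
  intro x hx
  have hs : cellSet D (signVec D x) ∈ E.faces := by
    rw [hD.faces_eq hp]
    exact ⟨x, hx, rfl⟩
  rw [← span_cellSet hp hx]
  exact exists_inner_ne_zero hu hF hs
    ⟨normalize_mem_unitSphere hx, (signVec_normalize hx).le⟩
    (ne_zero_of_mem_unitSphere (normalize_mem_unitSphere hx))

/-- Containment in the closed hemisphere gives only u ≥ 0. At a zero of u, general position would
allow a small move within the cone to a negative value, so u is positive. -/
theorem Represents.restriction_faces_eq (hD : Represents E D) (hp : Pointed D) [Finite A]
    [Finite E.extra] (hu : GenPos D (innerₗ (Ambient d) u)) (hH : H ∈ E.elements) :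
    restriction E.faces (closedHemisphere u ∩ subsphere H) =
      cellSet D '' (cells D (innerₗ (Ambient d) u) H \ {signVec D 0}) := by
  ext s
  rw [restriction, hD.faces_eq hp]
  constructor
  · rintro ⟨⟨x, hx, rfl⟩, hs⟩
    refine ⟨_, ⟨⟨⟨x, ?_, rfl⟩, fun y hy0 hy => ?_⟩, fun h => hx (hp x h)⟩, rfl⟩
    · have := (hs ⟨normalize_mem_unitSphere hx, (signVec_normalize hx).le⟩).2.2
      exact (Submodule.smul_mem_iff _ (inv_ne_zero (norm_ne_zero_iff.2 hx))).1 this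
    · have hnonneg : ∀ z, z ≠ 0 → signVec D z ≤ signVec D x → 0 ≤ innerₗ (Ambient d) u z := by
        intro z hz0 hz
        have h1 := (hs ⟨normalize_mem_unitSphere hz0, (signVec_normalize hz0).trans_le hz⟩).1.2
        rw [inner_smul_right] at h1
        exact nonneg_of_mul_nonneg_right h1 (inv_pos.2 (norm_pos_iff.2 hz0))
      refine lt_of_le_of_ne (hnonneg y hy0 hy) fun h0 => ?_
      obtain ⟨w, hw, huw⟩ := hu y hy0
      have key : ∀ w ∈ flat D (signVec D y), ¬ innerₗ (Ambient d) u w < 0 := by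
        intro w hw huw
        obtain ⟨ε, hε, hs'⟩ := exists_signVec_eq hw
        have h1 : innerₗ (Ambient d) u (y + ε • w) < 0 := by
          rw [map_add, ← h0, zero_add, map_smul]
          exact mul_neg_of_pos_of_neg hε huw
        exact h1.not_ge (hnonneg _ (fun h => by simp [h] at h1) (hs' ▸ hy))
      rcases lt_or_gt_of_ne huw with h5 | h5
      · exact key w hw h5
      · exact key (-w) (neg_mem hw) (by rw [map_neg]; linarith)
  · rintro ⟨_, ⟨⟨⟨x, hx, rfl⟩, h⟩, h0⟩, rfl⟩
    have hx0 : x ≠ 0 := by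
      rintro rfl
      exact h0 rfl
    refine ⟨⟨x, hx0, rfl⟩, fun y hy => ⟨⟨hy.1, ?_⟩, hy.1, ?_⟩⟩
    · exact (h y (ne_zero_of_mem_unitSphere hy.1) hy.2).le
    · exact hD.mem_element_of_mem_flat hH hx (mem_flat_of_le hy.2)

theorem Represents.subset_arrangementUnion_iff (hD : Represents E D) {x : Ambient d} (hx : x ≠ 0) :
    cellSet D (signVec D x) ⊆ arrangementUnion A ↔
      ∃ i ∈ Set.range Sum.inl, signVec D x i = CSign.zero := by
  simp only [Set.mem_range, exists_exists_eq_and, signVec_eq_zero_iff, hD.center_inl]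
  constructor
  · intro h
    have := h ⟨normalize_mem_unitSphere hx, (signVec_normalize hx).le⟩
    simp only [arrangementUnion, Set.mem_iUnion] at this
    obtain ⟨K, hK, hxK⟩ := this
    exact ⟨⟨K, hK⟩, (Submodule.smul_mem_iff _ (inv_ne_zero (norm_ne_zero_iff.2 hx))).1 hxK.2⟩
  · rintro ⟨K, hxK⟩ y hy
    simp only [arrangementUnion, Set.mem_iUnion]
    exact ⟨K, K.2, hy.1, hD.mem_element_of_mem_flat (Or.inl ⟨K, Or.inr (Or.inr rfl)⟩) hxK
      (mem_flat_of_le hy.2)⟩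

theorem isSubcomplex_restriction (C : Set (Set (Ambient d))) (F U K : Set (Ambient d)) :
    IsSubcomplex (restriction C (F ∩ U ∩ K)) (restriction C (F ∩ K)) :=
  ⟨fun _ hs => ⟨hs.1, hs.2.trans (Set.inter_subset_inter_left _ Set.inter_subset_left)⟩,
    fun _ ht _ hs hst => ⟨hs.1, hst.trans ht.2⟩⟩

/-- From the complete removal of sign vectors to a collapsing sequence of the restriction. -/
theorem Represents.exists_collapsingSequence (hD : Represents E D) (hp : Pointed D) [Finite A]
    [Finite E.extra] (hA : A.Nonempty) (hu : GenPos D (innerₗ (Ambient d) u)) (hH : H ∈ E.elements)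
    {out : ℕ → Prop} (hout : ¬ out 0)
    (hcoll : Coll (Matchable D (Set.range Sum.inl) out) (cells D (innerₗ (Ambient d) u) H) ∅) :
    ∃ v ∈ restriction E.faces (closedHemisphere u ∩ arrangementUnion A ∩ subsphere H),
      faceDim v = 0 ∧
      Collapses (restriction E.faces (closedHemisphere u ∩ subsphere H)) {v} ∧
      ∃ Φ, IsCollapsingSequence (restriction E.faces (closedHemisphere u ∩ subsphere H)) {v} Φ ∧
        ∀ s, IsOutwardlyMatched
          (restriction E.faces (closedHemisphere u ∩ arrangementUnion A ∩ subsphere H)) Φ s →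
            ∃ r, out r ∧ faceDim s = (r : ℤ) - 1 := by
  have hCeq := hD.restriction_faces_eq hp hu hH
  set C := restriction E.faces (closedHemisphere u ∩ subsphere H) with hC
  set B := restriction E.faces (closedHemisphere u ∩ arrangementUnion A ∩ subsphere H) with hB
  have hBC : ∀ s ∈ C, s ∈ B ↔ s ⊆ arrangementUnion A := fun s hs =>
    ⟨fun h => fun y hy => (h.2 hy).1.2,
      fun h => ⟨hs.1, fun y hy => ⟨⟨(hs.2 hy).1, h hy⟩, (hs.2 hy).2⟩⟩⟩
  have hne : ∀ σ ∈ cells D (innerₗ (Ambient d) u) H \ {signVec D 0},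
      ∃ x, x ≠ 0 ∧ signVec D x = σ := by
    rintro _ ⟨⟨⟨x, -, rfl⟩, -⟩, h0⟩
    exact ⟨x, fun h => h0 (by rw [h]; rfl), rfl⟩
  have hbot : signVec D 0 ∈ cells D (innerₗ (Ambient d) u) H :=
    ⟨⟨0, H.zero_mem, rfl⟩, fun y hy0 hy => absurd (hp y (le_antisymm hy (signVec_zero_le _))) hy0⟩
  obtain ⟨σ, hσ, h0σ, ⟨hrk, hout'⟩, hcoll'⟩ :=
    hcoll.remove_bot hbot fun _ _ => signVec_zero_le _
  rw [rank_signVec_zero hp] at hrk hout'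
  have hσ' : σ ∈ cells D (innerₗ (Ambient d) u) H \ {signVec D 0} := ⟨hσ, h0σ.ne'⟩
  obtain ⟨x₀, hx₀, rfl⟩ := hne _ hσ'
  have hvC : cellSet D (signVec D x₀) ∈ C := hCeq ▸ ⟨_, hσ', rfl⟩
  have hvB : cellSet D (signVec D x₀) ∈ B := by
    rw [hBC _ hvC, hD.subset_arrangementUnion_iff hx₀]
    obtain ⟨h, hh⟩ := hA
    -- The zero cone lies in every element of 𝒜. Since rank 0 is not exempt, its partner, the final
    -- vertex, lies in the arrangement.
    exact (hout' ⟨Sum.inl ⟨h, hh⟩, ⟨_, rfl⟩, by rw [signVec_zero]⟩).resolve_right hout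
  let Q : Set (Ambient d) → Set (Ambient d) → Prop := fun s t =>
    s ∈ C ∧ t ∈ C ∧ faceDim t = faceDim s + 1 ∧
      (s ∈ B → t ∈ B ∨ ∃ r, out r ∧ faceDim s = (r : ℤ) - 1)
  have hcollC : Coll Q C {cellSet D (signVec D x₀)} := by
    have h1 : Coll (fun σ τ => Q (cellSet D σ) (cellSet D τ))
        (cells D (innerₗ (Ambient d) u) H \ {signVec D 0}) {signVec D x₀} := by
      refine hcoll'.mono ?_
      intro σ hσ τ hτ ⟨h1, h2⟩
      have hsC : cellSet D σ ∈ C := hCeq ▸ ⟨_, hσ, rfl⟩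
      have htC : cellSet D τ ∈ C := hCeq ▸ ⟨_, hτ, rfl⟩
      obtain ⟨x, hx, rfl⟩ := hne _ hσ
      obtain ⟨y, hy, rfl⟩ := hne _ hτ
      refine ⟨hsC, htC, ?_, ?_⟩
      · rw [faceDim_cellSet hp hx, faceDim_cellSet hp hy, h1]
        push_cast
        ring
      · rw [hBC _ hsC, hBC _ htC, hD.subset_arrangementUnion_iff hx,
          hD.subset_arrangementUnion_iff hy]
        exact fun h => (h2 h).imp_right fun h3 => ⟨_, h3, faceDim_cellSet hp hx⟩
    have h2 := h1.image (f := cellSet D) (B := ∅) (fun σ hσ τ hτ => by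
      obtain ⟨x, hx, rfl⟩ := hne _ hσ
      exact cellSet_subset_iff hx) (by simp)
    rwa [Set.empty_union, Set.empty_union, Set.image_singleton, ← hCeq] at h2
  obtain ⟨-, Φ, hΦ, hcrit, hΦQ⟩ := hcollC.exists_matching fun s t h => h.2.2.1
  refine ⟨_, hvB, ?_, hcollC.collapses, Φ, ⟨⟨by simpa using hvC, ?_⟩, hΦ, hcrit⟩, ?_⟩
  · rw [faceDim_cellSet hp hx₀, hrk]
    simp
  · rintro _ rfl s hs hsv
    rw [hCeq] at hs
    obtain ⟨σ, hσ, rfl⟩ := hs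
    obtain ⟨x, hx, rfl⟩ := hne _ hσ
    have hle := (cellSet_subset_iff hx).1 hsv
    obtain ⟨c, rfl⟩ := eq_smul_of_rank_eq_one (by rw [hrk]) hx₀ (mem_flat_of_le hle)
    have h1 := hσ.1.2 _ hx le_rfl
    rw [map_smul] at h1
    have hc : 0 < c := pos_of_mul_pos_left h1 (hσ'.1.2 _ hx₀ le_rfl).le
    rw [signVec_smul _ hc]
    rfl
  · rintro s ⟨hsB, t, htB, h | h⟩
    · exact ((hΦQ _ h).2.2.2 hsB).resolve_left htB
    -- A subcomplex contains the faces of its members, so outward matches only go up in dimension.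
    · refine absurd ((isSubcomplex_restriction _ _ _ _).2 s hsB t (hΦ.1.mem _ h).1 ?_) htB
      exact (hΦ.1.codim_one _ h).1.subset

theorem Represents.iInf_center_eq_sInf (hD : Represents E D) {B : Set (A ⊕ E.extra)}
    (hB : B ⊆ Set.range Sum.inl) :
    ⨅ i ∈ B, center D i = sInf {K | ∃ hK : K ∈ A, Sum.inl ⟨K, hK⟩ ∈ B} := by
  ext x
  simp only [Submodule.mem_iInf, Submodule.mem_sInf, Set.mem_ofPred_eq]
  constructor
  · rintro h K ⟨hK, hKB⟩
    have := h _ hKB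
    rwa [hD.center_inl] at this
  · intro h i hi
    obtain ⟨K, rfl⟩ := hB hi
    rw [hD.center_inl]
    exact h K ⟨K.2, hi⟩

theorem Represents.evenCodim (hD : Represents E D) (hA : IsTwoArrangement A) :
    EvenCodim D (Set.range Sum.inl) := by
  intro B hB _
  rw [hD.iInf_center_eq_sInf hB]
  refine or_iff_not_imp_left.2 fun hne => ?_
  have h1 := hA.codim_even {K | ∃ hK : K ∈ A, Sum.inl ⟨K, hK⟩ ∈ B} (fun K hK => hK.1)
    (subsphere_nonempty_iff.2 hne)
  obtain ⟨k, hk⟩ := h1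
  rw [subsphereDim] at hk
  have h2 : Module.finrank ℝ (Ambient d) = d + 1 := by simp [Ambient]
  have h3 := Submodule.finrank_le (sInf {K | ∃ hK : K ∈ A, Sum.inl ⟨K, hK⟩ ∈ B})
  refine ⟨k.toNat, ?_⟩
  rw [h2] at h3 ⊢
  omega

/-- The three choices of H are three stages of the same induction: the full space, the sign
hyperplane after the first sweep, and the element of 𝒜 after the second. The exponent is ((d + 1) -
1) / 2. -/
theorem Represents.coll_cells (hD : Represents E D) (hp : Pointed D) [Finite A]
    [Finite E.extra] (hA : IsTwoArrangement A) (hu : GenPos D (innerₗ (Ambient d) u)) {h : A}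
    (hH : E.Extends H h) {out : ℕ → Prop} (hout : sInf A = ⊥ → out (d / 2)) :
    Coll (Matchable D (Set.range Sum.inl) out) (cells D (innerₗ (Ambient d) u) H) ∅ := by
  have hfin : Module.finrank ℝ (Ambient d) = d + 1 := by simp [Ambient]
  have hd := hA.two_le ⟨h, h.2⟩
  have hinf : ⨅ i ∈ Set.range Sum.inl, center D i = sInf A := by
    rw [hD.iInf_center_eq_sInf subset_rfl]
    congr 1
    ext K
    simp
  have hmem : (Sum.inl h : A ⊕ E.extra) ∈ Set.range Sum.inl := ⟨h, rfl⟩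
  have hW : ∀ x ∈ H, flat D (signVec D x) ≤ H := fun x hx y hy =>
    hD.mem_element_of_mem_flat (Or.inl ⟨h, hH⟩) hx hy
  have hsign := E.sign_isHyperplane h
  have hdim := hA.dim_eq h h.2
  rw [IsHyperplane, subsphereDim] at hsign
  rw [subsphereDim] at hdim
  rcases hH with rfl | rfl | rfl
  · refine coll_cells_of_evenCodim (d + 1) hfin (by omega) hp hu ⟨_, hmem⟩ (hD.evenCodim hA) ?_
    rw [hinf]
    exact hout
  · rw [← hD.ker_inl] at hW hsign ⊢
    obtain ⟨m, rfl⟩ : ∃ m, d = m + 1 := ⟨d - 1, by omega⟩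
    have hx : ∃ x, (D (Sum.inl h)).1 x ≠ 0 := by
      by_contra! hcon
      rw [LinearMap.ker_eq_top.2 (LinearMap.ext hcon), finrank_top] at hsign
      omega
    obtain ⟨x, hx⟩ := hx
    have hm : (restrictData D (LinearMap.ker (D (Sum.inl h)).1) (Sum.inl h)).2 ≠ 0 := by
      intro h0
      have h1 : center D (Sum.inl h) = LinearMap.ker (D (Sum.inl h)).1 :=
        inf_eq_left.2 fun y hy => LinearMap.congr_fun h0 ⟨y, hy⟩
      rw [← h1, hD.center_inl] at hsign
      omega
    refine coll_of_restrictData hW (coll_cells_restrictData_ker_fst m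
      (fun {_} _ _ _ => coll_cells_of_evenCodim m) hfin hmem hx hm
      (hD.evenCodim hA) ?_ (restrictData_pointed hp _) (restrictData_genPos hu hW))
    rw [hinf]
    exact hout
  · refine coll_of_restrictData hW (coll_cells_of_center_eq_top (by omega)
      (restrictData_pointed hp _) (restrictData_genPos hu hW) hmem ?_ out)
    refine (Submodule.eq_top_iff').2 fun w => ?_
    have hw : (w : Ambient d) ∈ center D (Sum.inl h) := by
      rw [hD.center_inl]
      exact w.2
    exact mem_center.2 (mem_center.1 hw)

theorem isCollapsiblePair_singleton {V : Type*} [AddCommGroup V] [Module ℝ V] {v : Set V}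
    (hv : faceDim v = 0) : IsCollapsiblePair {v} {v} := by
  have hsub : IsSubcomplex {v} {v} := ⟨subset_rfl, fun _ _ _ hs _ => hs⟩
  refine ⟨hsub, Or.inr ⟨v, rfl, hv, Relation.ReflTransGen.refl, ∅,
    ⟨hsub, ⟨⟨by simp, by simp, by simp⟩, ?_⟩, by simp [criticalFaces]⟩, ?_⟩⟩
  · rintro k s t ⟨-, h, -⟩
    exact h 0 (Nat.zero_le k)
  · rintro s ⟨-, t, -, h | h⟩ <;> exact h

theorem IsCollapsiblePair.isOutCollapsible {V : Type*} [AddCommGroup V] [Module ℝ V]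
    {C B : Set (Set V)} (h : IsCollapsiblePair C B) (j : ℤ) : IsOutCollapsible j C B := by
  refine ⟨h.1, h.2.imp_right ?_⟩
  rintro ⟨v, hv, hv0, hc, Φ, hΦ, hout⟩
  exact ⟨v, hv, hv0, hc, Φ, hΦ, fun s hs => absurd hs (hout s)⟩

theorem Represents.mem_flat_zero (hD : Represents E D) {x : Ambient d}
    (hx : ∀ K ∈ E.elements, x ∈ K) : x ∈ flat D (signVec D 0) := by
  refine mem_flat_signVec.2 fun i => ?_
  rcases i with h | K
  · have h1 := hx h (Or.inl ⟨h, Or.inr (Or.inr rfl)⟩)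
    rw [← hD.center_inl, mem_center] at h1
    exact ⟨fun _ => h1.1, fun _ _ => h1.2⟩
  · have h1 := hx K (Or.inr K.2)
    rw [← hD.ker_inr] at h1
    exact ⟨fun _ => h1, fun _ _ => by rw [hD.snd_inr, LinearMap.zero_apply]⟩

/-- A common point of all subspaces of the extension is a stratum, if there are at most two. -/
theorem Represents.stratum_eq_singleton (hD : Represents E D) {e : Ambient d}
    (he : e ∈ unitSphere d) (hspan : ∀ y ∈ flat D (signVec D 0), ∃ c : ℝ, c • e = y)
    {S : Set (Submodule ℝ (Ambient d))} {y z : Ambient d} (hy : y ∈ flat D (signVec D 0))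
    (hz : z ∈ E.stratum S y) : z = y := by
  have hyS := (JoinedIn.source_mem hz).2.2
  have hS : ∀ K ∈ E.elements, K ∈ S := fun K hK => by
    by_contra hKS
    exact hyS K ⟨hK, hKS⟩ (hD.mem_element_of_mem_flat hK K.zero_mem hy)
  have hc : ∀ w ∈ {w | w ∈ unitSphere d ∧ (∀ K ∈ S, w ∈ K) ∧ ∀ K ∈ E.elements \ S, w ∉ K},
      ∃ c : ℝ, |c| = 1 ∧ c • e = w := by
    rintro w ⟨hw, hwS, -⟩
    obtain ⟨c, rfl⟩ := hspan w (hD.mem_flat_zero fun K hK => hwS K (hS K hK))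
    refine ⟨c, ?_, rfl⟩
    rwa [mem_unitSphere, norm_smul, mem_unitSphere.1 he, mul_one] at hw
  have hval : ∀ c : ℝ, innerₗ (Ambient d) e (c • e) = c := fun c => by
    rw [map_smul, innerₗ_apply_apply, real_inner_self_eq_norm_sq, mem_unitSphere.1 he]
    simp
  -- The curve can only visit e and -e, where the inner product with e is 1 and -1, so it never
  -- leaves its starting point.
  have hsign := sign_eq_of_joinedIn hz (innerₗ (Ambient d) e) (Or.inl fun w hw => by
    obtain ⟨c, hc1, rfl⟩ := hc w hw
    rw [hval]
    rintro rfl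
    simp at hc1)
  obtain ⟨a, ha, rfl⟩ := hc y (JoinedIn.source_mem hz)
  obtain ⟨b, hb, rfl⟩ := hc z (JoinedIn.target_mem hz)
  rw [hval, hval] at hsign
  rcases eq_or_eq_neg_of_abs_eq ha with rfl | rfl <;>
    rcases eq_or_eq_neg_of_abs_eq hb with rfl | rfl
  · rfl
  · norm_num at hsign
  · norm_num at hsign
  · rfl

/-- If the subspaces of the extension have a pair of antipodal points in common, then the
restrictions to a hemisphere consist of one of these points. -/
theorem Represents.isCollapsiblePair_of_not_pointed (hD : Represents E D) (hE : E.IsFine)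
    (hA : A.Nonempty) (hp : ¬ Pointed D) (hu : u ≠ 0)
    (hF : InGeneralPosition (normalHyperplane u) E.faces) (hH : H ∈ E.elements) :
    IsCollapsiblePair (restriction E.faces (closedHemisphere u ∩ subsphere H))
      (restriction E.faces (closedHemisphere u ∩ arrangementUnion A ∩ subsphere H)) := by
  have hM := finrank_flat_zero_le_one hE hD
  obtain ⟨x, hx, hx0⟩ : ∃ x, signVec D x = signVec D 0 ∧ x ≠ 0 := by
    simpa only [Pointed, not_forall, exists_prop] using hp
  have hxM : x ∈ flat D (signVec D 0) := hx ▸ self_mem_flat x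
  have hrank : rank D (signVec D x) = 1 := le_antisymm (hx ▸ hM) (rank_pos hx0)
  have hspan' : ∀ e : Ambient d, e ∈ flat D (signVec D 0) → e ≠ 0 →
      signVec D e = signVec D 0 := by
    intro e he he0
    funext i
    have h1 := mem_flat_signVec.1 he i
    simp only [map_zero, forall_const] at h1
    simp [signVec, h1]
  have hspan : ∀ e ∈ flat D (signVec D 0), e ≠ 0 →
      ∀ y ∈ flat D (signVec D 0), ∃ c : ℝ, c • e = y := by
    intro e he he0 y hy
    have h1 := hspan' e he he0
    exact eq_smul_of_rank_eq_one (by rw [h1, ← hx, hrank]) he0 (h1 ▸ hy)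
  have hface : ∀ e ∈ flat D (signVec D 0), e ∈ unitSphere d → {e} ∈ E.faces := by
    intro e he he1
    have he0 := ne_zero_of_mem_unitSphere he1
    have hself : e ∈ E.stratum E.elements e := JoinedIn.refl ⟨he1, fun K hK =>
      hD.mem_element_of_mem_flat hK K.zero_mem he, fun K hK => absurd hK.1 hK.2⟩
    refine ⟨{e}, ⟨Set.singleton_nonempty e, E.elements, subset_rfl, e, ?_⟩, closure_singleton⟩
    refine (Set.eq_singleton_iff_unique_mem.2 ⟨hself, fun z hz => ?_⟩).symm
    exact hD.stratum_eq_singleton he1 (hspan e he he0) he hz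
  -- Each of the two common points is a face, so general position keeps them off the boundary; e is
  -- the one in the open hemisphere.
  obtain ⟨e, heM, he1, hue⟩ : ∃ e ∈ flat D (signVec D 0), e ∈ unitSphere d ∧ 0 < inner ℝ u e := by
    have h1 := normalize_mem_unitSphere hx0
    have h2 : (‖x‖⁻¹ : ℝ) • x ∈ flat D (signVec D 0) := Submodule.smul_mem _ _ hxM
    generalize (‖x‖⁻¹ : ℝ) • x = e at h1 h2
    obtain ⟨y, hy, huy⟩ := exists_inner_ne_zero hu hF (hface e h2 h1) rfl
      (ne_zero_of_mem_unitSphere h1)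
    obtain ⟨c, rfl⟩ := Submodule.mem_span_singleton.1 hy
    rw [inner_smul_right] at huy
    rcases lt_or_gt_of_ne (right_ne_zero_of_mul huy) with h | h
    · refine ⟨-e, neg_mem h2, ?_, by rw [inner_neg_right]; linarith⟩
      rw [mem_unitSphere, norm_neg]
      exact mem_unitSphere.1 h1
    · exact ⟨e, h2, h1, h⟩
  have he0 := ne_zero_of_mem_unitSphere he1
  have huniq : ∀ s ∈ E.faces, s ⊆ closedHemisphere u → s = {e} := by
    rintro _ ⟨c, ⟨⟨z, hz⟩, S, hSE, y, rfl⟩, rfl⟩ hsub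
    obtain ⟨hy, hS, hS'⟩ := JoinedIn.source_mem hz
    by_cases hy0 : signVec D y = signVec D 0
    · have hyM : y ∈ flat D (signVec D 0) := hy0 ▸ self_mem_flat y
      have h1 : E.stratum S y = {y} := Set.eq_singleton_iff_unique_mem.2
        ⟨JoinedIn.refl ⟨hy, hS, hS'⟩,
          fun w hw => hD.stratum_eq_singleton he1 (hspan e heM he0) hyM hw⟩
      rw [h1, closure_singleton] at hsub ⊢
      obtain ⟨a, rfl⟩ := hspan e heM he0 y hyM
      have h2 := (hsub rfl).2
      rw [inner_smul_right] at h2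
      have h3 : |a| = 1 := by
        rwa [mem_unitSphere, norm_smul, mem_unitSphere.1 he1, mul_one] at hy
      rw [abs_of_nonneg (nonneg_of_mul_nonneg_left h2 hue)] at h3
      rw [h3, one_smul]
    · exfalso
      rw [hD.stratum_eq hy hS hS' hSE hy0, closure_signVec_fiber] at hsub
      -- The point -e has the zero sign vector, so it belongs to the closure of every other stratum,
      -- and no such face fits into the hemisphere.
      have h1 : -e ∈ cellSet D (signVec D y) := by
        refine ⟨?_, ?_⟩
        · rw [mem_unitSphere, norm_neg]
          exact mem_unitSphere.1 he1
        · rw [hspan' _ (neg_mem heM) (neg_ne_zero.2 he0)]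
          exact signVec_zero_le _
      have h2 := (hsub h1).2
      rw [inner_neg_right] at h2
      linarith
  have hmemK : ∀ K ∈ E.elements, e ∈ K := fun K hK =>
    hD.mem_element_of_mem_flat hK K.zero_mem heM
  have hB : restriction E.faces (closedHemisphere u ∩ arrangementUnion A ∩ subsphere H) = {{e}} := by
    refine Set.eq_singleton_iff_unique_mem.2 ⟨⟨hface e heM he1, ?_⟩, fun s hs =>
      huniq s hs.1 fun y hy => (hs.2 hy).1.1⟩
    rintro _ rfl
    obtain ⟨K, hK⟩ := hA
    refine ⟨⟨⟨he1, hue.le⟩, ?_⟩, he1, hmemK H hH⟩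
    simp only [arrangementUnion, Set.mem_iUnion]
    exact ⟨K, hK, he1, hmemK K (Or.inl ⟨⟨K, hK⟩, Or.inr (Or.inr rfl)⟩)⟩
  have hC : restriction E.faces (closedHemisphere u ∩ subsphere H) = {{e}} := by
    refine Set.eq_singleton_iff_unique_mem.2 ⟨?_, fun s hs =>
      huniq s hs.1 fun y hy => (hs.2 hy).1⟩
    exact (isSubcomplex_restriction _ _ _ _).1 (hB ▸ rfl :
      {e} ∈ restriction E.faces (closedHemisphere u ∩ arrangementUnion A ∩ subsphere H))
  rw [hB, hC]
  refine isCollapsiblePair_singleton ?_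
  rw [faceDim, finrank_span_singleton he0]
  rfl

end Main

end HemisphereCollapse

theorem mainTheorem4 (d : ℕ)
    (A : Set (Submodule ℝ (HemisphereCollapse.Ambient d)))
    (hA : HemisphereCollapse.IsTwoArrangement A) (hne : A.Nonempty)
    (E : HemisphereCollapse.HyperplaneExtension A) (hE : E.IsFine)
    (u : HemisphereCollapse.Ambient d) (hu : u ≠ 0)
    (hF : HemisphereCollapse.InGeneralPosition (HemisphereCollapse.normalHyperplane u) E.faces)
    (H : Submodule ℝ (HemisphereCollapse.Ambient d)) (hH : ∃ h : A, E.Extends H h) :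
    HemisphereCollapse.IsOutCollapsible ((d : ℤ) / 2 - 1)
      (HemisphereCollapse.restriction E.faces
        (HemisphereCollapse.closedHemisphere u ∩ HemisphereCollapse.subsphere H))
      (HemisphereCollapse.restriction E.faces
        (HemisphereCollapse.closedHemisphere u ∩ HemisphereCollapse.arrangementUnion A ∩
          HemisphereCollapse.subsphere H)) ∧
    (¬ HemisphereCollapse.IsEssential A →
      HemisphereCollapse.IsCollapsiblePair
        (HemisphereCollapse.restriction E.faces
          (HemisphereCollapse.closedHemisphere u ∩ HemisphereCollapse.subsphere H))
        (HemisphereCollapse.restriction E.faces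
          (HemisphereCollapse.closedHemisphere u ∩ HemisphereCollapse.arrangementUnion A ∩
            HemisphereCollapse.subsphere H))) := by
  obtain ⟨D, hD⟩ := HemisphereCollapse.exists_represents hA E
  have : Finite A := hA.finite.to_subtype
  have : Finite E.extra := E.extra_finite.to_subtype
  have hHE : H ∈ E.elements := Or.inl hH
  by_cases hp : HemisphereCollapse.Pointed D
  · obtain ⟨h, hH⟩ := hH
    have hgen := hD.genPos hp hu hF
    have hd := hA.two_le hne
    refine ⟨⟨HemisphereCollapse.isSubcomplex_restriction _ _ _ _, Or.inr ?_⟩, fun hess =>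
      ⟨HemisphereCollapse.isSubcomplex_restriction _ _ _ _, Or.inr ?_⟩⟩
    -- A nonempty arrangement has d ≥ 2, so the exempt rank d / 2 is not 0; a cone of rank r is a
    -- face of dimension r - 1.
    · obtain ⟨v, hv, hv0, hc, Φ, hΦ, hout⟩ := hD.exists_collapsingSequence hp hne hgen hHE
        (out := fun r => r = d / 2) (by omega) (hD.coll_cells hp hA hgen hH fun _ => rfl)
      refine ⟨v, hv, hv0, hc, Φ, hΦ, fun s hs => ?_⟩
      obtain ⟨r, rfl, hr⟩ := hout s hs
      rw [hr]
      push_cast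
      rfl
    -- For non-essential 𝒜 no rank has to be exempted.
    · obtain ⟨v, hv, hv0, hc, Φ, hΦ, hout⟩ := hD.exists_collapsingSequence hp hne hgen hHE
        (out := fun _ => False) id (hD.coll_cells hp hA hgen hH fun h0 =>
          hess (HemisphereCollapse.isEssential_iff.2 h0))
      exact ⟨v, hv, hv0, hc, Φ, hΦ, fun s hs => (hout s hs).elim fun _ h => h.1⟩
  · have h := hD.isCollapsiblePair_of_not_pointed hE hne hp hu hF hHE
    exact ⟨h.isOutCollapsible _, fun _ => h⟩
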